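/- A crossed module $(H,G,\mu)$ is a group homomorphism $\mu\colon H\to G$ with an action of $G$ on $H$ such that $\mu({}^gh)=g\mu(h)g^{-1}$ and ${}^{\mu(h)}h'=hh'h^{-1}$. Its nerve $\mathcal N_*(H,G,\mu)$ is the simplicial group obtained as the nerve of the internal category in groups $H\rtimes G\rightrightarrows G$ with source $(h,g)\mapsto g$ and target $(h,g)\mapsto\mu(h)g$. An abelian crossed module is a homomorphism $\nu\colon C\to A$ of abelian groups (with the trivial action of $A$ on $C$). An action of $(H,G,\mu)$ on $(C,A,\nu)$ consists of actions of $G$ on $C$ and $A$ for which $\nu$ is equivariant and a map $\xi\colon H\times A\to C$, additive in the second variable, with $\nu\xi(h,a)={}^{\mu(h)}a-a$, $\xi(h,\nu(c))={}^{\mu(h)}c-c$, ${}^g\xi(h,a)=\xi({}^gh,{}^ga)$ and $\xi(hh',a)={}^{\mu(h)}\xi(h',a)+\xi(h,a)$; it induces an action of $\mathcal N_*(H,G,\mu)$ on $\mathcal N_*(C,A,\nu)$. The homology $H_n((H,G,\mu),(C,A,\nu))$ is the $n$th homology of the total complex of the bicomplex whose $p$th column is the complex $B_*(\mathcal N_p(H,G,\mu))\otimes_{\mathcal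 N_p(H,G,\mu)}\mathcal N_p(C,A,\nu)$, where $B_*$ is the bar resolution, with horizontal differential the alternating sum of the maps induced by the faces. One writes $H_n(H,G,\mu)$ for the homology with coefficients in $(0,\mathbb Z,0)$ with the trivial action. Let $$0\to (H',G',\mu')\to (H,G,\mu)\to (H'',G'',\mu'')\to 0$$ be a short exact sequence of crossed modules (that is, $1\to H'\to H\to H''\to 1$ and $1\to G'\to G\to G''\to 1$ are exact). Then there is an exact sequence $$H_2(H,G,\mu)\to H_2(H'',G'',\mu'')\to \frac{G'}{\mu'(H')[G,G']}\to \frac{G}{\mu(H)[G,G]}\to \frac{G''}{\mu''(H'')[G'',G'']}\to 0,$$ in which all maps except the second one are induced by the morphisms of the short exact sequence. Moreover, let $(H',G',\mu')_{ab}$ be the abelian crossed module $H'/[G',H']\to G'/[G',G']$ induced by $\mu'$, where $[G',H']$ is the normal subgroup of $H'$ generated by all ${}^{g}hh^{-1}$ with $g\in G'$, $h\in H'$, and let $(H'',G'',\mu'')$ act on it as follows: an element of $G''$ acts on both groups through a lift to $G$ (by conjugation on $G'$ and by the given action on $H'$), and $\xi(h,k)$ is the class of $\tilde h\,{}^k\tilde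 h^{-1}$ for a lift $\tilde h\in H$ of $h\in H''$. Then there are a homomorphism $$d\colon H_3(H'',G'',\mu'')\to H_1\big((H'',G'',\mu''),(H',G',\mu')_{ab}\big)$$ and an epimorphism $$\operatorname{Ker}\big(H_2(H,G,\mu)\to H_2(H'',G'',\mu'')\big)\twoheadrightarrow \operatorname{Coker}(d).$$ -/

import Mathlib

open CategoryTheory

universe u w


section BarComplex

variable {G : Type u} [Group G] {A : Type w} [AddCommGroup A] (ρ : Representation ℤ G A)

/-- The bar differential
`∂((g₁, …, gₙ₊₁) ⊗ a) = (g₂, …, gₙ₊₁) ⊗ g₁⁻¹ a + ∑ⱼ (-1)ʲ (…, gⱼ gⱼ₊₁, …) ⊗ a`,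
where for the last index the entry `gₙ₊₁` is dropped. Here `(Fin n → G) →₀ A` is
`Bₙ(G) ⊗_G A` for the standard resolution `Bₙ(G) = ℤ[G]^{⊗ (n + 1)}`, the basis element
`(g₁, …, gₙ) ⊗ a` being `(1 ⊗ g₁ ⊗ ⋯ ⊗ gₙ) ⊗ a`. -/
noncomputable def barD (n : ℕ) : ((Fin (n + 1) → G) →₀ A) →ₗ[ℤ] ((Fin n → G) →₀ A) :=
  Finsupp.lsum ℤ fun g =>
    Finsupp.lsingle (fun i => g i.succ) ∘ₗ ρ (g 0)⁻¹ +
      ∑ j : Fin (n + 1), (-1 : ℤ) ^ ((j : ℕ) + 1) • Finsupp.lsingle (j.contractNth (· * ·) g)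

theorem barD_single (n : ℕ) (g : Fin (n + 1) → G) (a : A) :
    barD ρ n (Finsupp.single g a) = Finsupp.single (fun i => g i.succ) (ρ (g 0)⁻¹ a) +
      ∑ j : Fin (n + 1), (-1 : ℤ) ^ ((j : ℕ) + 1) •
        Finsupp.single (j.contractNth (· * ·) g) a := by
  simp [barD]

/-- The faces of which the bar differential is the alternating sum (used only for `∂ ∘ ∂ = 0`). -/
noncomputable def barFace (n : ℕ) (i : Fin (n + 2)) :
    ((Fin (n + 1) → G) →₀ A) →ₗ[ℤ] ((Fin n → G) →₀ A) :=
  Finsupp.lsum ℤ fun g =>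
    Finsupp.lsingle (fun k : Fin n => (Fin.partialProd g (i.succAbove k.castSucc))⁻¹ *
        Fin.partialProd g (i.succAbove k.succ)) ∘ₗ
      ρ (Fin.partialProd g (i.succAbove 0))⁻¹

theorem barD_eq_sum (n : ℕ) :
    barD ρ n = ∑ i : Fin (n + 2), (-1 : ℤ) ^ (i : ℕ) • barFace ρ n i := by
  refine Finsupp.lhom_ext fun g a => ?_
  have h1 : ∀ k : Fin n, (Fin.partialProd g k.succ.castSucc)⁻¹ * Fin.partialProd g k.succ.succ
      = g k.succ := fun k => by
    rw [Fin.partialProd_succ]; group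
  have h2 : ∀ j : Fin (n + 1), (fun k : Fin n =>
      (Fin.partialProd g (j.succ.succAbove k.castSucc))⁻¹ *
        Fin.partialProd g (j.succ.succAbove k.succ)) = j.contractNth (· * ·) g := fun j => by
    funext k
    rw [← Fin.inv_partialProd_mul_eq_contractNth, Fin.succ_succAbove_succ]
  have h3 : ρ (Fin.partialProd g 1)⁻¹ a = ρ (g 0)⁻¹ a := by
    have : Fin.partialProd g 1 = g 0 := by
      have := Fin.partialProd_succ g 0
      simpa using this
    rw [this]
  rw [barD_single, LinearMap.sum_apply, Fin.sum_univ_succ (n := n + 1)]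
  congr 1
  · simp [barFace, ← h1, h3]
  · refine Finset.sum_congr rfl fun j _ => ?_
    have h4 : (fun k : Fin n => (Fin.partialProd g (j.succ.succAbove k.castSucc))⁻¹ *
        Fin.partialProd g (j.succAbove k).succ) = j.contractNth (· * ·) g := by
      rw [← h2]; simp
    simp [barFace, h4]

theorem partialProd_face {n : ℕ} (P : Fin (n + 1) → G) (k : Fin (n + 1)) :
    Fin.partialProd (fun k : Fin n => (P k.castSucc)⁻¹ * P k.succ) k = (P 0)⁻¹ * P k := by
  induction k using Fin.induction with
  | zero => simp
  | succ k ih => rw [Fin.partialProd_succ, ih]; group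

theorem barFace_comp (n : ℕ) (i : Fin (n + 2)) (j : Fin (n + 3)) (g : Fin (n + 2) → G) (a : A) :
    barFace ρ n i (barFace ρ (n + 1) j (Finsupp.single g a)) =
      Finsupp.single (fun k : Fin n =>
        (Fin.partialProd g (j.succAbove (i.succAbove k.castSucc)))⁻¹ *
        Fin.partialProd g (j.succAbove (i.succAbove k.succ)))
      (ρ (Fin.partialProd g (j.succAbove (i.succAbove 0)))⁻¹ a) := by
  have key := partialProd_face (fun k => Fin.partialProd g (j.succAbove k))
  simp only [barFace, Finsupp.lsum_single, LinearMap.comp_apply, Finsupp.lsingle_apply]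
  simp only [key, ← Module.End.mul_apply, ← map_mul]
  congr 1
  · funext k; group
  · congr 2; group

theorem barD_barD (n : ℕ) : barD ρ n ∘ₗ barD ρ (n + 1) = 0 := by
  refine Finsupp.lhom_ext fun g a => ?_
  rw [barD_eq_sum, barD_eq_sum]
  simp only [LinearMap.comp_apply, LinearMap.sum_apply, map_sum, LinearMap.smul_apply, map_smul,
    Finset.smul_sum, ← Finset.sum_product', LinearMap.zero_apply]
  let S : Finset (Fin (n + 3) × Fin (n + 2)) := {ij | (ij.1 : ℕ) ≤ (ij.2 : ℕ)}
  rw [Finset.univ_product_univ, ← Finset.sum_add_sum_compl S, ← eq_neg_iff_add_eq_zero,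
    ← Finset.sum_neg_distrib]
  let φ : ∀ ij : Fin (n + 3) × Fin (n + 2), ij ∈ S → Fin (n + 3) × Fin (n + 2) := fun ij hij =>
    (ij.2.succ, Fin.castLT ij.1 (lt_of_le_of_lt (Finset.mem_filter.mp hij).right (Fin.is_lt ij.2)))
  apply Finset.sum_bij φ
  · intro ij hij
    simp_rw [S, φ, Finset.compl_filter, Finset.mem_filter_univ, Fin.val_succ,
      Fin.val_castLT] at hij ⊢
    lia
  · rintro ⟨i, j⟩ hij ⟨i', j'⟩ hij' h
    simp only [φ, Prod.mk.injEq, Fin.ext_iff, Fin.val_succ, Fin.val_castLT] at h ⊢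
    lia
  · rintro ⟨i', j'⟩ hij'
    simp_rw [S, Finset.compl_filter, Finset.mem_filter_univ, not_le] at hij'
    refine ⟨(j'.castSucc, i'.pred ?_), ?_, ?_⟩
    · rintro rfl
      simp at hij'
    · simpa [S] using! Nat.le_sub_one_of_lt hij'
    · simp [φ]
  · rintro ⟨i, j⟩ hij
    simp only [S, Finset.mem_filter_univ] at hij
    have hs : ∀ k : Fin (n + 1), i.succAbove (j.succAbove k) =
        j.succ.succAbove ((i.castLT (lt_of_le_of_lt hij j.is_lt)).succAbove k) := by
      intro k
      ext
      simp only [Fin.succAbove, Fin.lt_def, Fin.val_castSucc, Fin.val_castLT, Fin.val_succ]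
      split_ifs <;> simp_all <;> lia
    simp only [barFace_comp, smul_smul, ← neg_smul, hs, φ]
    congr 1
    simp only [Fin.val_succ, Fin.val_castLT, pow_succ]
    ring

/-- The complex `B_*(G) ⊗_G A` computing the homology of the group `G` with coefficients in the
`G`-module `A`. -/
noncomputable abbrev barChains : ChainComplex (ModuleCat.{max u w} ℤ) ℕ :=
  ChainComplex.of (fun n => ModuleCat.of ℤ ((Fin n → G) →₀ A))
    (fun n => ModuleCat.ofHom (barD ρ n)) fun n => by
      rw [← ModuleCat.ofHom_comp, barD_barD]; rfl

theorem barChains_d (n : ℕ) : (barChains ρ).d (n + 1) n = ModuleCat.ofHom (barD ρ n) := by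
  exact ChainComplex.of_d (fun n => ModuleCat.of ℤ ((Fin n → G) →₀ A))
    (fun n => ModuleCat.ofHom (barD ρ n)) n

variable {G' : Type u} [Group G'] {A' : Type w} [AddCommGroup A']
  {ρ} {ρ' : Representation ℤ G' A'}

/-- The map `(g₁, …, gₙ) ⊗ a ↦ (f g₁, …, f gₙ) ⊗ φ a`. -/
noncomputable def barMap (f : G →* G') (φ : A →ₗ[ℤ] A') (n : ℕ) :
    ((Fin n → G) →₀ A) →ₗ[ℤ] ((Fin n → G') →₀ A') :=
  Finsupp.lsum ℤ fun g => Finsupp.lsingle (fun i => f (g i)) ∘ₗ φ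

theorem barMap_single (f : G →* G') (φ : A →ₗ[ℤ] A') (n : ℕ) (g : Fin n → G) (a : A) :
    barMap f φ n (Finsupp.single g a) = Finsupp.single (fun i => f (g i)) (φ a) := by
  simp [barMap]

theorem barMap_barD (f : G →* G') (φ : A →ₗ[ℤ] A')
    (h : ∀ g a, φ (ρ g a) = ρ' (f g) (φ a)) (n : ℕ) :
    barD ρ' n ∘ₗ barMap f φ (n + 1) = barMap f φ n ∘ₗ barD ρ n := by
  refine Finsupp.lhom_ext fun g a => ?_
  have := fun j : Fin (n + 1) => Fin.comp_contractNth (· * ·) (· * ·) (f := f) (map_mul f) j g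
  simp only [Function.comp_def] at this
  simp [barMap_single, barD_single, h, this, -Finsupp.smul_single, -zsmul_eq_mul]

/-- The chain map induced by a group homomorphism and an equivariant map of coefficients. -/
noncomputable def barChainsMap (f : G →* G') (φ : A →ₗ[ℤ] A')
    (h : ∀ g a, φ (ρ g a) = ρ' (f g) (φ a)) : barChains ρ ⟶ barChains ρ' :=
  ChainComplex.ofHom (fun n => ModuleCat.ofHom (barMap f φ n)) fun n => by
    rw [barChains_d, barChains_d]
    exact ModuleCat.hom_ext (barMap_barD f φ h n)

theorem barChainsMap_f (f : G →* G') (φ : A →ₗ[ℤ] A')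
    (h : ∀ g a, φ (ρ g a) = ρ' (f g) (φ a)) (n : ℕ) :
    (barChainsMap f φ h).f n = ModuleCat.ofHom (barMap f φ n) := rfl

theorem barChainsMap_id (f : G →* G) (φ : A →ₗ[ℤ] A) (h : ∀ g a, φ (ρ g a) = ρ (f g) (φ a))
    (hf : ∀ g, f g = g) (hφ : ∀ a, φ a = a) : barChainsMap f φ h = 𝟙 (barChains ρ) :=
  HomologicalComplex.hom_ext _ _ fun n => ModuleCat.hom_ext <|
    Finsupp.lhom_ext fun g a => by
      change barMap _ _ n _ = Finsupp.single g a
      simp [barMap_single, hf, hφ]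

theorem barChainsMap_comp {G'' : Type u} [Group G''] {A'' : Type w} [AddCommGroup A'']
    {ρ'' : Representation ℤ G'' A''} (f : G →* G') (φ : A →ₗ[ℤ] A')
    (h : ∀ g a, φ (ρ g a) = ρ' (f g) (φ a)) (f' : G' →* G'') (φ' : A' →ₗ[ℤ] A'')
    (h' : ∀ g a, φ' (ρ' g a) = ρ'' (f' g) (φ' a)) (f'' : G →* G'') (φ'' : A →ₗ[ℤ] A'')
    (h'' : ∀ g a, φ'' (ρ g a) = ρ'' (f'' g) (φ'' a))
    (hf : ∀ g, f'' g = f' (f g)) (hφ : ∀ a, φ'' a = φ' (φ a)) :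
    barChainsMap f'' φ'' h'' = barChainsMap f φ h ≫ barChainsMap f' φ' h' :=
  HomologicalComplex.hom_ext _ _ fun n => ModuleCat.hom_ext <|
    Finsupp.lhom_ext fun g a => by
      change barMap _ _ n _ = barMap _ _ n (barMap _ _ n _)
      simp [barMap_single, hf, hφ]

theorem barChainsMap_square {G'' G''' : Type u} [Group G''] [Group G'''] {A'' A''' : Type w}
    [AddCommGroup A''] [AddCommGroup A'''] {ρ'' : Representation ℤ G'' A''}
    {ρ''' : Representation ℤ G''' A'''} (f : G →* G') (φ : A →ₗ[ℤ] A')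
    (h : ∀ g a, φ (ρ g a) = ρ' (f g) (φ a)) (f' : G' →* G'') (φ' : A' →ₗ[ℤ] A'')
    (h' : ∀ g a, φ' (ρ' g a) = ρ'' (f' g) (φ' a)) (k : G →* G''') (ψ : A →ₗ[ℤ] A''')
    (l : ∀ g a, ψ (ρ g a) = ρ''' (k g) (ψ a)) (k' : G''' →* G'') (ψ' : A''' →ₗ[ℤ] A'')
    (l' : ∀ g a, ψ' (ρ''' g a) = ρ'' (k' g) (ψ' a))
    (hf : ∀ g, f' (f g) = k' (k g)) (hφ : ∀ a, φ' (φ a) = ψ' (ψ a)) :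
    barChainsMap f φ h ≫ barChainsMap f' φ' h' = barChainsMap k ψ l ≫ barChainsMap k' ψ' l' :=
  HomologicalComplex.hom_ext _ _ fun n => ModuleCat.hom_ext <|
    Finsupp.lhom_ext fun g a => by
      change barMap _ _ n (barMap _ _ n _) = barMap _ _ n (barMap _ _ n _)
      simp [barMap_single, hf, hφ]

end BarComplex

/-- A crossed module `(H, G, μ)`: a homomorphism `μ : H → G` and an action of `G` on `H`. -/
structure CrossedModule (H G : Type u) [Group H] [Group G] where
  /-- the boundary homomorphism -/
  μ : H →* G
  /-- the action `(g, h) ↦ ᵍh` -/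
  act : G →* MulAut H
  precrossed : ∀ g h, μ (act g h) = g * μ h * g⁻¹
  peiffer : ∀ h h', act (μ h) h' = h * h' * h⁻¹

namespace CrossedModule

/-- Morphisms of crossed modules. -/
structure Hom {H G H' G' : Type u} [Group H] [Group G] [Group H'] [Group G']
    (X : CrossedModule H G) (Y : CrossedModule H' G') where
  /-- the component `H → H'` -/
  onH : H →* H'
  /-- the component `G → G'` -/
  onG : G →* G'
  comm : ∀ h, Y.μ (onH h) = onG (X.μ h)
  equivariant : ∀ g h, onH (X.act g h) = Y.act (onG g) (onH h)

section Nerve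

/-- The pairs `i ≤ j` in `{0, …, n}`. -/
abbrev Edge (n : ℕ) : Type := {e : Fin (n + 1) × Fin (n + 1) // e.1 ≤ e.2}

/-- The pair `i ≤ j`. -/
abbrev edge {n : ℕ} {i j : Fin (n + 1)} (h : i ≤ j) : Edge n := ⟨(i, j), h⟩

/-- The action of order preserving maps on pairs. -/
def Edge.map {m n : ℕ} (f : Fin (m + 1) →o Fin (n + 1)) (e : Edge m) : Edge n :=
  ⟨(f e.1.1, f e.1.2), f.monotone e.2⟩

variable {H G : Type u} [Group H] [Group G] (X : CrossedModule H G)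

/-- The source `(h, g) ↦ g` in the internal category `H ⋊ G ⇉ G`. -/
def src : H ⋊[X.act] G →* G := SemidirectProduct.rightHom

/-- The target `(h, g) ↦ μ(h) g` in the internal category `H ⋊ G ⇉ G`. -/
def tgt : H ⋊[X.act] G →* G :=
  SemidirectProduct.lift X.μ (MonoidHom.id G) fun g => by
    ext h; simp [X.precrossed]

/-- The composition `(h', g') ∘ (h, g) = (h' h, g)`, meant for `g' = μ(h) g`. -/
def comp (a b : H ⋊[X.act] G) : H ⋊[X.act] G := ⟨a.left * b.left, b.right⟩

theorem src_apply (a : H ⋊[X.act] G) : X.src a = a.right := rfl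

theorem tgt_apply (a : H ⋊[X.act] G) : X.tgt a = X.μ a.left * a.right := rfl

theorem comp_mul_comp {a b a' b' : H ⋊[X.act] G} (h : X.src a = X.tgt b) :
    X.comp (a * a') (b * b') = X.comp a b * X.comp a' b' := by
  rw [src_apply, tgt_apply] at h
  ext
  · simp [comp, h, X.peiffer, mul_assoc]
  · simp [comp]

/-- The group `Nerve_n(H, G, μ)` of `n`-simplices of the nerve of the internal category
`H ⋊ G ⇉ G`, with the pointwise multiplication. A simplex is a family of arrows
`x i j : v j ⟶ v i`, `i ≤ j`, with `x i k = x i j ∘ x j k`. It is determined by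
`(h₁, …, hₙ, g)` where `x (i - 1) i = (hᵢ, -)` and `v n = g`. -/
def nerve (n : ℕ) : Subgroup (Edge n → H ⋊[X.act] G) where
  carrier := {x | ∀ (i j k : Fin (n + 1)) (hij : i ≤ j) (hjk : j ≤ k),
    X.src (x (edge hij)) = X.tgt (x (edge hjk)) ∧
      x (edge (hij.trans hjk)) = X.comp (x (edge hij)) (x (edge hjk))}
  mul_mem' {x y} hx hy i j k hij hjk := by
    refine ⟨?_, ?_⟩
    · rw [Pi.mul_apply, Pi.mul_apply, map_mul, map_mul, (hx i j k hij hjk).1,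
        (hy i j k hij hjk).1]
    · rw [Pi.mul_apply, Pi.mul_apply, Pi.mul_apply, comp_mul_comp X (hx i j k hij hjk).1,
        (hx i j k hij hjk).2, (hy i j k hij hjk).2]
  one_mem' i j k hij hjk := by
    refine ⟨by simp, ?_⟩
    ext <;> simp [comp]
  inv_mem' {x} hx i j k hij hjk := by
    refine ⟨?_, ?_⟩
    · rw [Pi.inv_apply, Pi.inv_apply, map_inv, map_inv, (hx i j k hij hjk).1]
    · rw [Pi.inv_apply, Pi.inv_apply, Pi.inv_apply, inv_eq_iff_mul_eq_one,
        (hx i j k hij hjk).2, ← comp_mul_comp X (hx i j k hij hjk).1, mul_inv_cancel,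
        mul_inv_cancel]
      ext <;> simp [comp]

/-- The simplicial operators of the nerve. -/
def nerveMap {m n : ℕ} (f : Fin (m + 1) →o Fin (n + 1)) : X.nerve n →* X.nerve m where
  toFun x := ⟨fun e => x.1 (e.map f), fun i j k hij hjk =>
    x.2 (f i) (f j) (f k) (f.monotone hij) (f.monotone hjk)⟩
  map_one' := rfl
  map_mul' _ _ := rfl

variable {X} in
/-- The map of arrows induced by a morphism of crossed modules. -/
def Hom.onArrows {H' G' : Type u} [Group H'] [Group G'] {Y : CrossedModule H' G'}
    (f : Hom X Y) : H ⋊[X.act] G →* H' ⋊[Y.act] G' :=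
  SemidirectProduct.map f.onH f.onG fun g => by
    ext h; simp [f.equivariant]

variable {X} in
/-- The map of nerves induced by a morphism of crossed modules. -/
def Hom.onNerve {H' G' : Type u} [Group H'] [Group G'] {Y : CrossedModule H' G'}
    (f : Hom X Y) (n : ℕ) : X.nerve n →* Y.nerve n where
  toFun x := ⟨fun e => f.onArrows (x.1 e), fun i j k hij hjk => by
    obtain ⟨h1, h2⟩ := x.2 i j k hij hjk
    refine ⟨?_, ?_⟩
    · have := congrArg f.onG h1
      simpa [src_apply, tgt_apply, Hom.onArrows, f.comm] using this
    · beta_reduce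
      rw [h2]
      ext <;> simp [comp, Hom.onArrows]⟩
  map_one' := by ext : 2; exact map_one f.onArrows
  map_mul' _ _ := by ext : 2; exact map_mul f.onArrows _ _

end Nerve

section Coefficients

/-! An abelian crossed module `(C, A, ν)`, written additively, is a homomorphism `ν : C →+ A` of
abelian groups (with the trivial action of `A` on `C`). -/

variable {C A : Type w} [AddCommGroup C] [AddCommGroup A] (ν : C →+ A)

/-- The abelian group `Nerve_n(C, A, ν)`: families of arrows `x i j : w j ⟶ w i`, `i ≤ j`, with
`x i k = x i j ∘ x j k`, where `(c, a) ∈ C × A` is an arrow `a ⟶ ν(c) + a`. -/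
def abNerve (n : ℕ) : AddSubgroup (Edge n → C × A) where
  carrier := {x | ∀ (i j k : Fin (n + 1)) (hij : i ≤ j) (hjk : j ≤ k),
    (x (edge hij)).2 = ν (x (edge hjk)).1 + (x (edge hjk)).2 ∧
      x (edge (hij.trans hjk)) =
        ((x (edge hij)).1 + (x (edge hjk)).1, (x (edge hjk)).2)}
  add_mem' {x y} hx hy i j k hij hjk := by
    obtain ⟨h1, h2⟩ := hx i j k hij hjk
    obtain ⟨h3, h4⟩ := hy i j k hij hjk
    refine ⟨?_, ?_⟩
    · simp only [Pi.add_apply, Prod.snd_add, Prod.fst_add, map_add, h1, h3]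
      abel
    · simp only [Pi.add_apply, h2, h4]
      ext
      · simp only [Prod.fst_add]
        abel
      · simp
  zero_mem' i j k hij hjk := by
    refine ⟨by simp, ?_⟩
    ext <;> simp
  neg_mem' {x} hx i j k hij hjk := by
    obtain ⟨h1, h2⟩ := hx i j k hij hjk
    refine ⟨?_, ?_⟩
    · simp only [Pi.neg_apply, Prod.snd_neg, Prod.fst_neg, map_neg, h1]
      abel
    · simp only [Pi.neg_apply, h2]
      ext
      · simp only [Prod.fst_neg]
        abel
      · simp

/-- The simplicial operators of the nerve of an abelian crossed module. -/
def abNerveMap {m n : ℕ} (f : Fin (m + 1) →o Fin (n + 1)) : abNerve ν n →ₗ[ℤ] abNerve ν m :=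
  AddMonoidHom.toIntLinearMap
    { toFun x := ⟨fun e => x.1 (e.map f), fun i j k hij hjk =>
        x.2 (f i) (f j) (f k) (f.monotone hij) (f.monotone hjk)⟩
      map_zero' := rfl
      map_add' _ _ := rfl }

variable {H G : Type u} [Group H] [Group G] (X : CrossedModule H G)

/-- An action of a crossed module `(H, G, μ)` on an abelian crossed module `(C, A, ν)`: actions of
`G` on `C` and `A` together with a map `ξ : H × A → C`; the group `H` acts through `μ`. (The
condition `ᵍ(ᵖm) = ^(ᵍp)(ᵍm)` is void, as `A` acts trivially on `C`.) -/
structure Action where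
  /-- the action of `G` on `C` -/
  actC : Representation ℤ G C
  /-- the action of `G` on `A` -/
  actA : Representation ℤ G A
  /-- the map `ξ : H × A → C` -/
  ξ : H → A → C
  map_act : ∀ g c, ν (actC g c) = actA g (ν c)
  map_ξ : ∀ h a, ν (ξ h a) = actA (X.μ h) a - a
  ξ_map : ∀ h c, ξ h (ν c) = actC (X.μ h) c - c
  act_ξ : ∀ g h a, actC g (ξ h a) = ξ (X.act g h) (actA g a)
  ξ_mul : ∀ h h' a, ξ (h * h') a = actC (X.μ h) (ξ h' a) + ξ h a
  ξ_add : ∀ h a a', ξ h (a + a') = ξ h a + ξ h a'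

/-- The trivial action. -/
def trivialAction : Action ν X where
  actC := 1
  actA := 1
  ξ _ _ := 0
  map_act _ _ := rfl
  map_ξ _ _ := by simp
  ξ_map _ _ := by simp
  act_ξ _ _ _ := by simp
  ξ_mul _ _ _ := by simp
  ξ_add _ _ _ := by simp

namespace Action

variable {ν X} (α : Action ν X)

theorem ξ_one (a : A) : α.ξ 1 a = 0 := by
  have := α.ξ_mul 1 1 a
  simpa using this

theorem ξ_zero (h : H) : α.ξ h 0 = 0 := by
  have := α.ξ_add h 0 0
  simpa using this

/-- The action of the group `H ⋊ G` of arrows on the group `C × A` of arrows, which is conjugation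
in the semidirect product `(C, A, ν) ⋊ (H, G, μ)`:
`(h, g) • (c, a) = (^(μ(h) g) c + ξ(h, ᵍa), ᵍa)`. -/
def onArrows : Representation ℤ (H ⋊[X.act] G) (C × A) where
  toFun x := AddMonoidHom.toIntLinearMap
    { toFun y := (α.actC (X.tgt x) y.1 + α.ξ x.left (α.actA (X.src x) y.2),
        α.actA (X.src x) y.2)
      map_zero' := by simp [ξ_zero]
      map_add' y z := by
        ext
        · simp only [Prod.fst_add, Prod.snd_add, map_add, α.ξ_add]
          abel
        · simp }
  map_one' := by
    ext y <;> simp [ξ_one]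
  map_mul' x y := by
    refine LinearMap.ext fun z => ?_
    ext
    · simp [α.ξ_mul, α.act_ξ, tgt_apply, src_apply, map_mul, add_assoc]
    · simp

theorem onArrows_apply (x : H ⋊[X.act] G) (y : C × A) :
    α.onArrows x y = (α.actC (X.μ x.left * x.right) y.1 + α.ξ x.left (α.actA x.right y.2),
      α.actA x.right y.2) := rfl

theorem onArrows_mem (n : ℕ) (x : X.nerve n) (y : abNerve ν n) :
    (fun e => α.onArrows (x.1 e) (y.1 e)) ∈ abNerve ν n := by
  intro i j k hij hjk
  obtain ⟨h1, h2⟩ := x.2 i j k hij hjk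
  obtain ⟨h3, h4⟩ := y.2 i j k hij hjk
  rw [src_apply, tgt_apply] at h1
  simp only [onArrows_apply, h2, h4, comp]
  refine ⟨?_, ?_⟩
  · simp [h1, h3, α.map_act, α.map_ξ]
    abel
  · ext
    · have key : α.actA (x.1 (edge hij)).right (y.1 (edge hij)).2 =
          ν (α.actC (x.1 (edge hij)).right (y.1 (edge hjk)).1 +
            α.ξ (x.1 (edge hjk)).left (α.actA (x.1 (edge hjk)).right (y.1 (edge hjk)).2)) +
          α.actA (x.1 (edge hjk)).right (y.1 (edge hjk)).2 := by
        simp [h1, h3, α.map_act, α.map_ξ]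
        abel
      rw [key, α.ξ_add, α.ξ_map, α.ξ_mul, h1]
      simp only [map_mul, map_add, Module.End.mul_apply]
      abel
    · rfl

/-- The pointwise action of the nerve of `(H, G, μ)` on the nerve of `(C, A, ν)`. -/
def onNerve (n : ℕ) : Representation ℤ (X.nerve n) (abNerve ν n) where
  toFun x := AddMonoidHom.toIntLinearMap
    { toFun y := ⟨fun e => α.onArrows (x.1 e) (y.1 e), α.onArrows_mem n x y⟩
      map_zero' := by ext : 2; exact map_zero (α.onArrows _)
      map_add' _ _ := by ext : 2; exact map_add (α.onArrows _) _ _ }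
  map_one' := by
    refine LinearMap.ext fun y => Subtype.ext (funext fun e => ?_)
    exact congrArg (fun φ => φ (y.1 e)) (map_one α.onArrows)
  map_mul' x x' := by
    refine LinearMap.ext fun y => Subtype.ext (funext fun e => ?_)
    exact congrArg (fun φ => φ (y.1 e)) (map_mul α.onArrows (x.1 e) (x'.1 e))

/-- The action of the source induced by a morphism of crossed modules. -/
def comap {H' G' : Type u} [Group H'] [Group G'] {Y : CrossedModule H' G'}
    (α : Action ν Y) (f : Hom X Y) : Action ν X where
  actC := α.actC.comp f.onG
  actA := α.actA.comp f.onG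
  ξ h a := α.ξ (f.onH h) a
  map_act _ _ := α.map_act _ _
  map_ξ _ _ := by simp [α.map_ξ, f.comm]
  ξ_map _ _ := by simp [α.ξ_map, f.comm]
  act_ξ _ _ _ := by simp [α.act_ξ, f.equivariant]
  ξ_mul _ _ _ := by simp [α.ξ_mul, f.comm]
  ξ_add _ _ _ := α.ξ_add _ _ _

end Action

end Coefficients

section Homology

variable {C A : Type w} [AddCommGroup C] [AddCommGroup A] {ν : C →+ A}
  {H G : Type u} [Group H] [Group G] {X : CrossedModule H G}

/-- The simplicial chain complex `p ↦ B_*(Nerve_p(H, G, μ)) ⊗ Nerve_p(C, A, ν)`. -/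
noncomputable def simplicialChains (α : Action ν X) :
    SimplicialObject (ChainComplex (ModuleCat.{max u w} ℤ) ℕ) where
  obj p := barChains (α.onNerve p.unop.len)
  map f := barChainsMap (X.nerveMap f.unop.toOrderHom) (abNerveMap ν f.unop.toOrderHom)
    fun _ _ => rfl
  map_id _ := barChainsMap_id _ _ _ (fun _ => rfl) fun _ => rfl
  map_comp _ _ := barChainsMap_comp _ _ _ _ _ _ _ _ _ (fun _ => rfl) fun _ => rfl

/-- The bicomplex `B(Nerve_*(H, G, μ), Nerve_*(C, A, ν))`: the complexes
`B_*(Nerve_p(H, G, μ)) ⊗ Nerve_p(C, A, ν)`, connected by the alternating sums of the faces. -/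
noncomputable def bicomplex (α : Action ν X) :
    HomologicalComplex₂ (ModuleCat.{max u w} ℤ) (ComplexShape.down ℕ) (ComplexShape.down ℕ) :=
  (AlgebraicTopology.alternatingFaceMapComplex _).obj (simplicialChains α)

/-- The total complex `Tot B(Nerve_*(H, G, μ), Nerve_*(C, A, ν))`. -/
noncomputable def tot (α : Action ν X) : ChainComplex (ModuleCat.{max u w} ℤ) ℕ :=
  (bicomplex α).total (ComplexShape.down ℕ)

/-- The homology `Hₙ((H, G, μ), (C, A, ν))`. -/
noncomputable def homology (α : Action ν X) (n : ℕ) : ModuleCat.{max u w} ℤ :=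
  (tot α).homology n

theorem Action.comap_onNerve {H' G' : Type u} [Group H'] [Group G']
    {Y : CrossedModule H' G'} (α : Action ν Y) (f : Hom X Y) (n : ℕ) (x : X.nerve n)
    (y : abNerve ν n) : (α.comap f).onNerve n x y = α.onNerve n (f.onNerve n x) y := by
  refine Subtype.ext (funext fun e => ?_)
  change (α.comap f).onArrows (x.1 e) (y.1 e) = α.onArrows (f.onArrows (x.1 e)) (y.1 e)
  simp [Action.onArrows_apply, Action.comap, Hom.onArrows, f.comm]

/-- The map on simplicial chain complexes induced by a morphism of crossed modules. -/
noncomputable def simplicialChainsMap {H' G' : Type u} [Group H'] [Group G']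
    {Y : CrossedModule H' G'} (α : Action ν Y) (f : Hom X Y) :
    simplicialChains (α.comap f) ⟶ simplicialChains α where
  app p := barChainsMap (f.onNerve p.unop.len) LinearMap.id (α.comap_onNerve f p.unop.len)
  naturality p q g := barChainsMap_square (X.nerveMap g.unop.toOrderHom)
    (abNerveMap ν g.unop.toOrderHom) (fun _ _ => rfl) (f.onNerve q.unop.len) LinearMap.id
    (α.comap_onNerve f q.unop.len) (f.onNerve p.unop.len) LinearMap.id
    (α.comap_onNerve f p.unop.len) (Y.nerveMap g.unop.toOrderHom)
    (abNerveMap ν g.unop.toOrderHom) (fun _ _ => rfl) (fun _ => rfl) (fun _ => rfl)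

/-- The map `Hₙ((H, G, μ), (C, A, ν)) → Hₙ((H', G', μ'), (C, A, ν))` induced by a morphism of
crossed modules, where `(H, G, μ)` acts through this morphism. -/
noncomputable def homologyMap {H' G' : Type u} [Group H'] [Group G']
    {Y : CrossedModule H' G'} (α : Action ν Y) (f : Hom X Y) (n : ℕ) :
    homology (α.comap f) n ⟶ homology α n :=
  HomologicalComplex.homologyMap (HomologicalComplex₂.total.map
    ((AlgebraicTopology.alternatingFaceMapComplex _).map (simplicialChainsMap α f))
    (ComplexShape.down ℕ)) n

/-- The integral homology `Hₙ(H, G, μ)`: the coefficients are `(0, ℤ, 0)` with the trivial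
action. -/
noncomputable def integralHomology (X : CrossedModule H G) (n : ℕ) : ModuleCat.{u} ℤ :=
  homology (trivialAction (0 : PUnit.{1} →+ ℤ) X) n

/-- The map on integral homology induced by a morphism of crossed modules. -/
noncomputable def integralHomologyMap {H' G' : Type u} [Group H'] [Group G']
    {Y : CrossedModule H' G'} (f : Hom X Y) (n : ℕ) :
    X.integralHomology n →ₗ[ℤ] Y.integralHomology n :=
  (homologyMap (trivialAction (0 : PUnit.{1} →+ ℤ) Y) f n).hom

end Homology

section Abelianization

variable {H G : Type u} [Group H] [Group G] (X : CrossedModule H G)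

/-- The normal subgroup `[G, H]` of `H` generated by all `ᵍh h⁻¹`. -/
def commH : Subgroup H := Subgroup.normalClosure {x | ∃ g h, x = X.act g h * h⁻¹}

instance : X.commH.Normal := Subgroup.normalClosure_normal

theorem act_mul_inv_mem (g : G) (h : H) : X.act g h * h⁻¹ ∈ X.commH :=
  Subgroup.subset_normalClosure ⟨g, h, rfl⟩

theorem mk_act (g : G) (h : H) : (X.act g h : H ⧸ X.commH) = h := by
  have := (QuotientGroup.eq_one_iff _).2 (X.act_mul_inv_mem g h)
  rwa [QuotientGroup.mk_mul, QuotientGroup.mk_inv, mul_inv_eq_one] at this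

instance : CommGroup (H ⧸ X.commH) :=
  { (inferInstance : Group (H ⧸ X.commH)) with
    mul_comm := by
      intro a b
      obtain ⟨h, rfl⟩ := QuotientGroup.mk_surjective a
      obtain ⟨h', rfl⟩ := QuotientGroup.mk_surjective b
      have := X.mk_act (X.μ h) h'
      rw [X.peiffer, QuotientGroup.mk_mul, QuotientGroup.mk_mul, QuotientGroup.mk_inv,
        mul_inv_eq_iff_eq_mul] at this
      exact this }

/-- The homomorphism `H/[G, H] → G/[G, G]` induced by `μ`. -/
def abMul : H ⧸ X.commH →* Abelianization G :=
  QuotientGroup.lift X.commH (Abelianization.of.comp X.μ) <| by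
    refine Subgroup.normalClosure_le_normal ?_
    rintro _ ⟨g, h, rfl⟩
    simp [MonoidHom.mem_ker, X.precrossed]

/-- The abelianisation `(H/[G, H], G/[G, G], μ)` of `(H, G, μ)`, an abelian crossed module,
written additively. -/
def ab : Additive (H ⧸ X.commH) →+ Additive (Abelianization G) := MonoidHom.toAdditive X.abMul

theorem abMul_mk (h : H) : X.abMul (h : H ⧸ X.commH) = Abelianization.of (X.μ h) := rfl

end Abelianization

variable {H' G' H G H'' G'' : Type u} [Group H'] [Group G'] [Group H] [Group G]
  [Group H''] [Group G''] {X' : CrossedModule H' G'} {X : CrossedModule H G}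
  {X'' : CrossedModule H'' G''}

/-- `0 → (H', G', μ') → (H, G, μ) → (H'', G'', μ'') → 0` is a short exact sequence of crossed
modules: both sequences of groups are short exact. -/
structure ShortExact (i : Hom X' X) (p : Hom X X'') : Prop where
  injective_H : Function.Injective i.onH
  injective_G : Function.Injective i.onG
  exact_H : i.onH.range = p.onH.ker
  exact_G : i.onG.range = p.onG.ker
  surjective_H : Function.Surjective p.onH
  surjective_G : Function.Surjective p.onG

namespace ShortExact

variable {i : Hom X' X} {p : Hom X X''} (S : ShortExact i p)

theorem onG_onG (S : ShortExact i p) (k : G') : p.onG (i.onG k) = 1 := by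
  have : i.onG k ∈ p.onG.ker := S.exact_G ▸ ⟨k, rfl⟩
  exact this

theorem onH_onH (S : ShortExact i p) (m : H') : p.onH (i.onH m) = 1 := by
  have : i.onH m ∈ p.onH.ker := S.exact_H ▸ ⟨m, rfl⟩
  exact this

theorem exists_onG (S : ShortExact i p) {g : G} (hg : p.onG g = 1) : ∃ k, i.onG k = g := by
  have : g ∈ i.onG.range := S.exact_G ▸ hg
  exact this

theorem exists_onH (S : ShortExact i p) {h : H} (hh : p.onH h = 1) : ∃ m, i.onH m = h := by
  have : h ∈ i.onH.range := S.exact_H ▸ hh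
  exact this

theorem exists_conjG (S : ShortExact i p) (g : G) (k : G') :
    ∃ l, i.onG l = g * i.onG k * g⁻¹ :=
  S.exists_onG (by simp [S.onG_onG])

theorem exists_conjH (S : ShortExact i p) (g : G) (m : H') :
    ∃ l, i.onH l = X.act g (i.onH m) :=
  S.exists_onH (by simp [p.equivariant, S.onH_onH])

theorem exists_comm (S : ShortExact i p) (h : H) (k : G') :
    ∃ l, i.onH l = h * X.act (i.onG k) h⁻¹ :=
  S.exists_onH (by simp [p.equivariant, S.onG_onG])

/-- The conjugation `k ↦ g k g⁻¹` by `g ∈ G`, as an endomorphism of `G'`. -/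
noncomputable def conjG (g : G) : G' →* G' :=
  have spec k := (S.exists_conjG g k).choose_spec
  { toFun k := (S.exists_conjG g k).choose
    map_one' := S.injective_G (by rw [spec]; simp)
    map_mul' k l := S.injective_G ((spec (k * l)).trans (by simp only [map_mul, spec]; group)) }

theorem onG_conjG (g : G) (k : G') : i.onG (S.conjG g k) = g * i.onG k * g⁻¹ :=
  (S.exists_conjG g k).choose_spec

/-- The action `m ↦ ᵍm` of `g ∈ G`, as an endomorphism of `H'`. -/
noncomputable def conjH (g : G) : H' →* H' :=
  have spec m := (S.exists_conjH g m).choose_spec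
  { toFun m := (S.exists_conjH g m).choose
    map_one' := S.injective_H (by rw [spec]; simp)
    map_mul' m l := S.injective_H ((spec (m * l)).trans (by simp only [map_mul, spec])) }

theorem onH_conjH (g : G) (m : H') : i.onH (S.conjH g m) = X.act g (i.onH m) :=
  (S.exists_conjH g m).choose_spec

/-- The element `h ᵏh⁻¹` of `H'`, for `h ∈ H` and `k ∈ G'`. -/
noncomputable def xi (h : H) (k : G') : H' := (S.exists_comm h k).choose

theorem onH_xi (h : H) (k : G') : i.onH (S.xi h k) = h * X.act (i.onG k) h⁻¹ :=
  (S.exists_comm h k).choose_spec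

theorem conjH_act (g : G) (k : G') (m : H') :
    S.conjH g (X'.act k m) = X'.act (S.conjG g k) (S.conjH g m) :=
  S.injective_H <| by simp [onH_conjH, i.equivariant, onG_conjG]

theorem conjH_le (g : G) : X'.commH ≤ X'.commH.comap (S.conjH g) := by
  refine Subgroup.normalClosure_le_normal ?_
  rintro _ ⟨k, m, rfl⟩
  simp only [Subgroup.coe_comap, Set.mem_preimage, map_mul, map_inv, SetLike.mem_coe, conjH_act]
  exact X'.act_mul_inv_mem _ _

/-- The endomorphism of `G'/[G', G']` induced by conjugation by `g ∈ G`. -/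
noncomputable def abConjG (g : G) : Abelianization G' →* Abelianization G' :=
  Abelianization.map (S.conjG g)

/-- The endomorphism of `H'/[G', H']` induced by the action of `g ∈ G`. -/
noncomputable def abConjH (g : G) : H' ⧸ X'.commH →* H' ⧸ X'.commH :=
  QuotientGroup.map _ _ (S.conjH g) (S.conjH_le g)

theorem abConjG_of (g : G) (k : G') :
    S.abConjG g (Abelianization.of k) = Abelianization.of (S.conjG g k) := rfl

theorem abConjH_mk (g : G) (m : H') : S.abConjH g (m : H' ⧸ X'.commH) = (S.conjH g m : H') := rfl

/-- The homomorphism `G'/[G', G'] → H'/[G', H']` given by `k ↦ h ᵏh⁻¹`, for `h ∈ H`. -/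
noncomputable def abXi (h : H) : Abelianization G' →* H' ⧸ X'.commH :=
  Abelianization.lift
    { toFun k := (S.xi h k : H' ⧸ X'.commH)
      map_one' := by
        rw [show S.xi h 1 = 1 from S.injective_H (by simp [onH_xi])]
        rfl
      map_mul' k l := by
        rw [show S.xi h (k * l) = S.xi h k * X'.act k (S.xi h l) from
          S.injective_H (by simp [onH_xi, i.equivariant, mul_assoc]), QuotientGroup.mk_mul,
          X'.mk_act] }

theorem abXi_of (h : H) (k : G') :
    S.abXi h (Abelianization.of k) = (S.xi h k : H' ⧸ X'.commH) := rfl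

theorem abConjG_congr {g g' : G} (hg : p.onG g = p.onG g') : S.abConjG g = S.abConjG g' := by
  obtain ⟨l, hl⟩ := S.exists_onG (g := g'⁻¹ * g) (by simp [hg])
  refine MonoidHom.ext fun a => ?_
  induction a using QuotientGroup.induction_on with | H k => ?_
  change S.abConjG g (Abelianization.of k) = S.abConjG g' (Abelianization.of k)
  rw [abConjG_of, abConjG_of, show S.conjG g k = S.conjG g' (l * k * l⁻¹) from
    S.injective_G (by simp only [onG_conjG, map_mul, map_inv, hl]; group)]
  simp

theorem abConjH_congr {g g' : G} (hg : p.onG g = p.onG g') : S.abConjH g = S.abConjH g' := by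
  obtain ⟨l, hl⟩ := S.exists_onG (g := g * g'⁻¹) (by simp [hg])
  refine MonoidHom.ext fun a => ?_
  induction a using QuotientGroup.induction_on with | H m => ?_
  rw [abConjH_mk, abConjH_mk, show S.conjH g m = X'.act l (S.conjH g' m) from
    S.injective_H (by simp [onH_conjH, i.equivariant, hl]), X'.mk_act]

theorem abXi_congr {h h' : H} (hh : p.onH h = p.onH h') : S.abXi h = S.abXi h' := by
  obtain ⟨m, hm⟩ := S.exists_onH (h := h * h'⁻¹) (by simp [hh])
  refine MonoidHom.ext fun a => ?_
  induction a using QuotientGroup.induction_on with | H k => ?_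
  change S.abXi h (Abelianization.of k) = S.abXi h' (Abelianization.of k)
  rw [abXi_of, abXi_of, show S.xi h k = m * S.xi h' k * (X'.act k m)⁻¹ from
    S.injective_H (by simp [onH_xi, i.equivariant, hm, mul_assoc]), QuotientGroup.mk_mul,
    QuotientGroup.mk_mul, QuotientGroup.mk_inv, X'.mk_act, mul_inv_cancel_comm]

/-- A lift of an element of `G''` to `G`. -/
noncomputable def liftG (x : G'') : G := (S.surjective_G x).choose

theorem onG_liftG (x : G'') : p.onG (S.liftG x) = x := (S.surjective_G x).choose_spec

/-- A lift of an element of `H''` to `H`. -/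
noncomputable def liftH (x : H'') : H := (S.surjective_H x).choose

theorem onH_liftH (x : H'') : p.onH (S.liftH x) = x := (S.surjective_H x).choose_spec

theorem abConjG_liftG (g : G) : S.abConjG (S.liftG (p.onG g)) = S.abConjG g :=
  S.abConjG_congr (S.onG_liftG _)

theorem abConjH_liftG (g : G) : S.abConjH (S.liftG (p.onG g)) = S.abConjH g :=
  S.abConjH_congr (S.onG_liftG _)

theorem abXi_liftH (h : H) : S.abXi (S.liftH (p.onH h)) = S.abXi h :=
  S.abXi_congr (S.onH_liftH _)

/-- The action of `(H'', G'', μ'')` on `(H', G', μ')_ab` given by the short exact sequence: an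
element of `G''` acts by conjugation with a lift to `G`, and `ξ(h, k)` is the class of `h̃ ᵏh̃⁻¹`
for a lift `h̃ ∈ H` of `h ∈ H''`. -/
noncomputable def action : Action X'.ab X'' where
  actC :=
    { toFun x := AddMonoidHom.toIntLinearMap (MonoidHom.toAdditive (S.abConjH (S.liftG x)))
      map_one' := by
        refine LinearMap.ext fun a => ?_
        rw [← map_one p.onG, abConjH_liftG]
        induction a using QuotientGroup.induction_on with | H m => ?_
        exact congrArg (QuotientGroup.mk (s := X'.commH))
          (S.injective_H (by simp [onH_conjH]) : S.conjH 1 m = m)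
      map_mul' x y := by
        refine LinearMap.ext fun a => ?_
        obtain ⟨g, rfl⟩ := S.surjective_G x
        obtain ⟨g', rfl⟩ := S.surjective_G y
        rw [← map_mul, abConjH_liftG, abConjH_liftG, abConjH_liftG]
        induction a using QuotientGroup.induction_on with | H m => ?_
        exact congrArg (QuotientGroup.mk (s := X'.commH)) (S.injective_H (by simp [onH_conjH]) :
          S.conjH (g * g') m = S.conjH g (S.conjH g' m)) }
  actA :=
    { toFun x := AddMonoidHom.toIntLinearMap (MonoidHom.toAdditive (S.abConjG (S.liftG x)))
      map_one' := by
        refine LinearMap.ext fun a => ?_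
        rw [← map_one p.onG, abConjG_liftG]
        induction a using QuotientGroup.induction_on with | H k => ?_
        exact congrArg Abelianization.of
          (S.injective_G (by simp [onG_conjG]) : S.conjG 1 k = k)
      map_mul' x y := by
        refine LinearMap.ext fun a => ?_
        obtain ⟨g, rfl⟩ := S.surjective_G x
        obtain ⟨g', rfl⟩ := S.surjective_G y
        rw [← map_mul, abConjG_liftG, abConjG_liftG, abConjG_liftG]
        induction a using QuotientGroup.induction_on with | H k => ?_
        exact congrArg Abelianization.of (S.injective_G (by simp [onG_conjG, mul_assoc]) :
          S.conjG (g * g') k = S.conjG g (S.conjG g' k)) }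
  ξ x a := Additive.ofMul (S.abXi (S.liftH x) a.toMul)
  map_act x a := by
    obtain ⟨g, rfl⟩ := S.surjective_G x
    change X'.abMul (S.abConjH _ a.toMul) = S.abConjG _ (X'.abMul a.toMul)
    rw [abConjG_liftG, abConjH_liftG]
    induction a.toMul using QuotientGroup.induction_on with | H m => ?_
    exact congrArg Abelianization.of (S.injective_G (by
      simp [onG_conjG, ← i.comm, onH_conjH, X.precrossed]) :
        X'.μ (S.conjH g m) = S.conjG g (X'.μ m))
  map_ξ x a := by
    obtain ⟨h, rfl⟩ := S.surjective_H x
    change X'.abMul (S.abXi _ a.toMul) = S.abConjG _ a.toMul / a.toMul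
    rw [abXi_liftH, p.comm, abConjG_liftG]
    induction a.toMul using QuotientGroup.induction_on with | H k => ?_
    exact congrArg Abelianization.of (S.injective_G (by
      simp [onG_conjG, ← i.comm, onH_xi, X.precrossed, div_eq_mul_inv, mul_assoc]) :
        X'.μ (S.xi h k) = S.conjG (X.μ h) k / k)
  ξ_map x a := by
    obtain ⟨h, rfl⟩ := S.surjective_H x
    change S.abXi _ (X'.abMul a.toMul) = S.abConjH _ a.toMul / a.toMul
    rw [abXi_liftH, p.comm, abConjH_liftG]
    induction a.toMul using QuotientGroup.induction_on with | H m => ?_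
    exact congrArg (QuotientGroup.mk (s := X'.commH)) (S.injective_H (by
      simp [onH_conjH, ← i.comm, onH_xi, X.peiffer, div_eq_mul_inv, mul_assoc]) :
        S.xi h (X'.μ m) = S.conjH (X.μ h) m / m)
  act_ξ x y a := by
    obtain ⟨g, rfl⟩ := S.surjective_G x
    obtain ⟨h, rfl⟩ := S.surjective_H y
    change S.abConjH _ (S.abXi _ a.toMul) = S.abXi _ (S.abConjG _ a.toMul)
    rw [← p.equivariant, abXi_liftH, abXi_liftH, abConjH_liftG, abConjG_liftG]
    induction a.toMul using QuotientGroup.induction_on with | H k => ?_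
    exact congrArg (QuotientGroup.mk (s := X'.commH)) (S.injective_H (by
      simp [onH_conjH, onG_conjG, onH_xi]) :
        S.conjH g (S.xi h k) = S.xi (X.act g h) (S.conjG g k))
  ξ_mul x y a := by
    obtain ⟨h, rfl⟩ := S.surjective_H x
    obtain ⟨h', rfl⟩ := S.surjective_H y
    change S.abXi _ a.toMul = S.abConjH _ (S.abXi _ a.toMul) * S.abXi _ a.toMul
    rw [← map_mul, abXi_liftH, abXi_liftH, abXi_liftH, p.comm, abConjH_liftG]
    induction a.toMul using QuotientGroup.induction_on with | H k => ?_
    exact congrArg (QuotientGroup.mk (s := X'.commH)) (S.injective_H (by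
      simp [onH_conjH, onH_xi, X.peiffer, mul_assoc]) :
        S.xi (h * h') k = S.conjH (X.μ h) (S.xi h' k) * S.xi h k)
  ξ_add x a a' := map_mul (S.abXi _) a.toMul a'.toMul

theorem action_actC (g : G) (m : H') :
    S.action.actC (p.onG g) (Additive.ofMul (m : H' ⧸ X'.commH)) =
      Additive.ofMul (S.conjH g m : H' ⧸ X'.commH) :=
  congrArg (fun φ => φ (m : H' ⧸ X'.commH)) (S.abConjH_liftG g)

theorem action_actA (g : G) (k : G') :
    S.action.actA (p.onG g) (Additive.ofMul (Abelianization.of k)) =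
      Additive.ofMul (Abelianization.of (S.conjG g k)) :=
  congrArg (fun φ => φ (Abelianization.of k)) (S.abConjG_liftG g)

theorem action_ξ (h : H) (k : G') :
    S.action.ξ (p.onH h) (Additive.ofMul (Abelianization.of k)) =
      Additive.ofMul (S.xi h k : H' ⧸ X'.commH) :=
  congrArg (fun φ => φ (Abelianization.of k)) (S.abXi_liftH h)

end ShortExact

section LowDegree

instance (X : CrossedModule H G) : X.μ.range.Normal :=
  ⟨by rintro _ ⟨h, rfl⟩ g; exact ⟨X.act g h, X.precrossed g h⟩⟩

/-- The normal subgroup `μ(H) [G, G]` of `G`. -/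
def muComm (X : CrossedModule H G) : Subgroup G := X.μ.range ⊔ commutator G

instance (X : CrossedModule H G) : X.muComm.Normal := Subgroup.sup_normal _ _

theorem muComm_le {Y : CrossedModule H' G'} {X : CrossedModule H G} (f : Hom X Y) :
    X.muComm ≤ Y.muComm.comap f.onG := by
  refine sup_le ?_ ?_
  · rintro _ ⟨h, rfl⟩
    exact Subgroup.mem_sup_left ⟨f.onH h, f.comm h⟩
  · refine Subgroup.commutator_le.2 fun a _ b _ => ?_
    rw [Subgroup.mem_comap, map_commutatorElement]
    exact Subgroup.mem_sup_right
      (Subgroup.commutator_mem_commutator (Subgroup.mem_top _) (Subgroup.mem_top _))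

/-- The homomorphism `G/(μ(H) [G, G]) → G'/(μ'(H') [G', G'])` induced by a morphism of crossed
modules. -/
def quotMap {Y : CrossedModule H' G'} {X : CrossedModule H G} (f : Hom X Y) :
    G ⧸ X.muComm →* G' ⧸ Y.muComm :=
  QuotientGroup.map _ _ f.onG (muComm_le f)

namespace ShortExact

variable {i : Hom X' X} {p : Hom X X''} (S : ShortExact i p)

/-- The normal subgroup `μ'(H') [G, G']` of `G'`, where `G'` is regarded as a subgroup of `G`. -/
def relMuComm (_ : ShortExact i p) : Subgroup G' :=
  X'.μ.range ⊔ (⁅(⊤ : Subgroup G), i.onG.range⁆).comap i.onG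

instance : S.relMuComm.Normal := by
  have : i.onG.range.Normal := S.exact_G ▸ p.onG.normal_ker
  exact Subgroup.sup_normal _ _

theorem relMuComm_le : S.relMuComm ≤ X.muComm.comap i.onG := by
  refine sup_le ?_ (Subgroup.comap_mono ?_)
  · rintro _ ⟨h, rfl⟩
    exact Subgroup.mem_sup_left ⟨i.onH h, i.comm h⟩
  · exact (Subgroup.commutator_mono le_rfl le_top).trans le_sup_right

/-- The homomorphism `G'/(μ'(H') [G, G']) → G/(μ(H) [G, G])` induced by `G' → G`. -/
def relQuotMap : G' ⧸ S.relMuComm →* G ⧸ X.muComm :=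
  QuotientGroup.map _ _ i.onG S.relMuComm_le

end ShortExact

end LowDegree

end CrossedModule

-- Write π for the map of nerves induced by `p`. The induced map from the total complex of integral
-- chains of `X` to that of `X''` is onto; let K be its kernel, which appears below only through
-- conditions of the form `f x = 0`. The long exact homology sequence contains H₃(X'') → H₂(K) →
-- H₂(X) → H₂(X'') → H₁(K) → H₁(X), so K has to be understood in degrees one and two. This is done
-- by comparing it with the complex M that computes homology with coefficients in (H', G', μ')_ab.
--
-- In simplicial degree n choose a set-theoretic section s of π, and let κ(g) be the class of
-- s(πg)⁻¹g in the nerve of the abelianised kernel (`nerveDiff`). The map (g₀, …, g_q) ⊗ r ↦ (πg₁,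
-- …, πg_q) ⊗ rκ(g₀) lowers the bar degree by one (`barShift`). It need not respect differentials on
-- all chains. However, a linear map whose values on generators depend only on their images under π
-- vanishes on the kernel in each bidegree (`eq_zero_of_barMap_eq_zero`), and the failure of
-- `barShift` to anticommute with the bar differential, or to commute with the faces, is of this
-- kind (`nerveDiff_cocycle`, `nerveDiff_nerveMap`). After a sign on the columns this gives a map K
-- → M of degree -1 that anticommutes with the differentials.
--
-- This map is onto, and its kernel L has H₁(L) = 0. Indeed K vanishes in bar degree zero, so only
-- bar degree one of column zero matters; there the nerve of `X'` is G', and the claim rests on the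
-- kernel of G' → G'_ab being the commutator subgroup (`exists_barD_eq`). Hence H₁(K) ≅ H₀(M), and
-- H₂(K) → H₁(M) is onto.
--
-- Explicit boundaries in low degrees identify H₀(M) with G'/μ'(H')[G, G'] through `toRel`, and
-- 1-chains of `X` modulo boundaries with G/μ(H)[G, G] through `toQuot`. This yields the first part
-- of the exact sequence (`exists_exact`); its right end is elementary group theory. Finally, d is
-- the composite H₃(X'') → H₂(K) → H₁(M). Since Ker(H₂(X) → H₂(X'')) is the cokernel of H₃(X'') →
-- H₂(K), the surjection H₂(K) → H₁(M) induces an epimorphism from it onto Coker(d)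
-- (`exists_surjective`).

universe v

/-! ### Homology of complexes of modules in terms of cycles and boundaries. -/

section ModuleHomology

variable {R : Type u} [Ring R]

/-- Descent along a quotient map. With `q` the class map on cycles, the hypothesis says that
boundaries go to zero, and the result is a map out of homology. -/
theorem LinearMap.exists_comp_eq_of_surjective {M N P : Type*} [AddCommGroup M] [AddCommGroup N]
    [AddCommGroup P] [Module R M] [Module R N] [Module R P] (q : M →ₗ[R] N) (r : M →ₗ[R] P)
    (hq : Function.Surjective q) (h : ∀ x, q x = 0 → r x = 0) : ∃ e : N →ₗ[R] P, ∀ x, e (q x) = r x := by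
  refine ⟨(LinearMap.ker q).liftQ r h ∘ₗ (q.quotKerEquivOfSurjective hq).symm.toLinearMap,
    fun x => ?_⟩
  have : (q.quotKerEquivOfSurjective hq).symm (q x) = Submodule.Quotient.mk x := by
    rw [LinearEquiv.symm_apply_eq]; rfl
  simp only [LinearMap.comp_apply, LinearEquiv.coe_coe, this]
  rfl

/-- The kernel of the differential, mapped to the object of cycles. -/
noncomputable def ModuleCat.kerToCycles (C : ChainComplex (ModuleCat.{w} R) ℕ) (n : ℕ) :
    LinearMap.ker (C.d (n + 1) n).hom →ₗ[R] C.cycles (n + 1) :=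
  (C.liftCycles (ModuleCat.ofHom (LinearMap.ker (C.d (n + 1) n).hom).subtype) n (by simp)
    (ModuleCat.hom_ext (LinearMap.ext fun x => x.2))).hom

theorem ModuleCat.iCycles_kerToCycles (C : ChainComplex (ModuleCat.{w} R) ℕ) (n : ℕ)
    (z : LinearMap.ker (C.d (n + 1) n).hom) :
    (C.iCycles (n + 1)).hom (ModuleCat.kerToCycles C n z) = z := by
  rw [ModuleCat.kerToCycles, ← LinearMap.comp_apply, ← ModuleCat.hom_comp,
    HomologicalComplex.liftCycles_i]
  rfl

/-- The homology class of a cycle. -/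
noncomputable def ModuleCat.homologyClass (C : ChainComplex (ModuleCat.{w} R) ℕ) (n : ℕ) :
    LinearMap.ker (C.d (n + 1) n).hom →ₗ[R] C.homology (n + 1) :=
  (C.homologyπ (n + 1)).hom ∘ₗ ModuleCat.kerToCycles C n

theorem ModuleCat.homologyClass_surjective (C : ChainComplex (ModuleCat.{w} R) ℕ) (n : ℕ) :
    Function.Surjective (ModuleCat.homologyClass C n) := by
  intro x
  obtain ⟨y, rfl⟩ := (ModuleCat.epi_iff_surjective (C.homologyπ (n + 1))).1 inferInstance x
  have hy : (C.d (n + 1) n).hom ((C.iCycles (n + 1)).hom y) = 0 := by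
    rw [← LinearMap.comp_apply, ← ModuleCat.hom_comp, HomologicalComplex.iCycles_d]; rfl
  refine ⟨⟨_, hy⟩, congrArg (C.homologyπ (n + 1)).hom ?_⟩
  exact (ModuleCat.mono_iff_injective (C.iCycles (n + 1))).1 inferInstance
    (ModuleCat.iCycles_kerToCycles C n _)

/-- Homology is the cokernel of `toCycles`, and `iCycles` is injective, so exactness at the object
of cycles can be read off inside `C.X (n + 1)`. -/
theorem ModuleCat.homologyClass_eq_zero_iff (C : ChainComplex (ModuleCat.{w} R) ℕ) (n : ℕ)
    (z : LinearMap.ker (C.d (n + 1) n).hom) :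
    ModuleCat.homologyClass C n z = 0 ↔ ∃ y, (C.d (n + 2) (n + 1)).hom y = z := by
  have h1 := ModuleCat.iCycles_kerToCycles C n z
  set c := ModuleCat.kerToCycles C n z
  have hex := (ShortComplex.moduleCat_exact_iff _).1 (ShortComplex.exact_of_g_is_cokernel
    (ShortComplex.mk _ _ (C.toCycles_comp_homologyπ (n + 2) (n + 1)))
    (C.homologyIsCokernel (n + 2) (n + 1) (by simp)))
  have h2 : ∀ y, (C.iCycles (n + 1)).hom ((C.toCycles (n + 2) (n + 1)).hom y) =
      (C.d (n + 2) (n + 1)).hom y := fun y => by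
    rw [← LinearMap.comp_apply, ← ModuleCat.hom_comp, HomologicalComplex.toCycles_i]
  constructor
  · intro h
    obtain ⟨y, hy⟩ := hex c h
    refine ⟨y, ?_⟩
    rw [← h1, ← h2]
    exact congrArg _ hy
  · rintro ⟨y, hy⟩
    have : c = (C.toCycles (n + 2) (n + 1)).hom y :=
      (ModuleCat.mono_iff_injective (C.iCycles (n + 1))).1 inferInstance
        (h1.trans (hy.symm.trans (h2 y).symm))
    change (C.homologyπ (n + 1)).hom c = 0
    rw [this, ← LinearMap.comp_apply, ← ModuleCat.hom_comp,
      HomologicalComplex.toCycles_comp_homologyπ]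
    rfl

theorem ModuleCat.homologyClass_map {C D : ChainComplex (ModuleCat.{w} R) ℕ} (f : C ⟶ D) (n : ℕ)
    (z : LinearMap.ker (C.d (n + 1) n).hom) (z' : LinearMap.ker (D.d (n + 1) n).hom)
    (h : (z' : D.X (n + 1)) = (f.f (n + 1)).hom z) :
    (HomologicalComplex.homologyMap f (n + 1)).hom (ModuleCat.homologyClass C n z) =
      ModuleCat.homologyClass D n z' := by
  change (HomologicalComplex.homologyMap f (n + 1)).hom ((C.homologyπ (n + 1)).hom _) =
    (D.homologyπ (n + 1)).hom _
  rw [← LinearMap.comp_apply, ← ModuleCat.hom_comp, HomologicalComplex.homologyπ_naturality]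
  refine congrArg (D.homologyπ (n + 1)).hom ?_
  refine (ModuleCat.mono_iff_injective (D.iCycles (n + 1))).1 inferInstance ?_
  change (D.iCycles (n + 1)).hom ((HomologicalComplex.cyclesMap f (n + 1)).hom _) =
    (D.iCycles (n + 1)).hom _
  rw [ModuleCat.iCycles_kerToCycles, h, ← LinearMap.comp_apply, ← ModuleCat.hom_comp,
    HomologicalComplex.cyclesMap_i, ModuleCat.hom_comp, LinearMap.comp_apply,
    ModuleCat.iCycles_kerToCycles]

end ModuleHomology

/-! ### Homological algebra of the kernel of a split epimorphism and a shifted comparison map. -/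

section ShiftedComparison

variable {R : Type u} [Ring R] {C D M : ChainComplex (ModuleCat.{w} R) ℕ} (f : C ⟶ D)

theorem ModuleCat.d_d_apply (C : ChainComplex (ModuleCat.{w} R) ℕ) (n : ℕ) (x : C.X (n + 2)) :
    (C.d (n + 1) n).hom ((C.d (n + 2) (n + 1)).hom x) = 0 := by
  rw [← LinearMap.comp_apply, ← ModuleCat.hom_comp, C.d_comp_d]; rfl

theorem ModuleCat.chainMap_d_apply (n : ℕ) (x : C.X (n + 1)) :
    (f.f n).hom ((C.d (n + 1) n).hom x) = (D.d (n + 1) n).hom ((f.f (n + 1)).hom x) := by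
  rw [← LinearMap.comp_apply, ← ModuleCat.hom_comp, ← f.comm]; rfl

/-- A map of degree `-1` from `C` to `M`, which anticommutes with the differentials on the kernel
of the degreewise split epimorphism `f : C ⟶ D`. In low degrees it is onto on this kernel, and
the kernel of the restriction has no homology in degree one. -/
structure ShiftedComparison (M : ChainComplex (ModuleCat.{w} R) ℕ) where
  /-- a degreewise section -/
  σ (n : ℕ) : D.X n →ₗ[R] C.X n
  map_σ (n : ℕ) (x : D.X n) : (f.f n).hom (σ n x) = x
  /-- the map of degree `-1` -/
  φ (n : ℕ) : C.X (n + 1) →ₗ[R] M.X n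
  φ_d (n : ℕ) (x : C.X (n + 2)) (hx : (f.f (n + 2)).hom x = 0) :
    φ n ((C.d (n + 2) (n + 1)).hom x) = -(M.d (n + 1) n).hom (φ (n + 1) x)
  exists_φ (n : ℕ) (m : M.X n) : ∃ y, (f.f (n + 1)).hom y = 0 ∧ φ n y = m
  exists_d (x : C.X 1) (hx : (f.f 1).hom x = 0) (hx' : φ 0 x = 0) :
    ∃ y : C.X 2, (f.f 2).hom y = 0 ∧ φ 1 y = 0 ∧ (C.d 2 1).hom y = x

namespace ShiftedComparison

variable {f} (Φ : ShiftedComparison f M)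

theorem φ_d_eq_zero (n : ℕ) (k : C.X (n + 2)) (hk : (f.f (n + 2)).hom k = 0)
    (hk' : (C.d (n + 2) (n + 1)).hom k = 0) : (M.d (n + 1) n).hom (Φ.φ (n + 1) k) = 0 := by
  rw [← neg_eq_zero, ← Φ.φ_d n k hk, hk', map_zero]

theorem map_d_σ (n : ℕ) (w : D.X (n + 1)) :
    (f.f n).hom ((C.d (n + 1) n).hom (Φ.σ (n + 1) w)) = (D.d (n + 1) n).hom w := by
  rw [ModuleCat.chainMap_d_apply, Φ.map_σ]

/-- The connecting homomorphism on cycles, followed by the comparison. -/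
noncomputable def connectingAux : LinearMap.ker (D.d 3 2).hom →ₗ[R] M.homology 1 :=
  ModuleCat.homologyClass M 0 ∘ₗ LinearMap.codRestrict (LinearMap.ker (M.d 1 0).hom)
    (Φ.φ 1 ∘ₗ (C.d 3 2).hom ∘ₗ Φ.σ 3 ∘ₗ (LinearMap.ker (D.d 3 2).hom).subtype) fun z =>
      Φ.φ_d_eq_zero 0 _ ((Φ.map_d_σ 2 z).trans z.2) (ModuleCat.d_d_apply C 1 _)

/-- This is the connecting map H₃(D) → H₂(ker f) followed by the map induced by `φ`: lift a cycle by
`σ`, take the boundary, apply `φ`. -/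
theorem exists_connecting : ∃ d : D.homology 3 →ₗ[R] M.homology 1,
    ∀ z, d (ModuleCat.homologyClass D 2 z) = Φ.connectingAux z := by
  refine LinearMap.exists_comp_eq_of_surjective _ _ (ModuleCat.homologyClass_surjective D 2)
    fun z hz => ?_
  obtain ⟨w, hw⟩ := (ModuleCat.homologyClass_eq_zero_iff D 2 z).1 hz
  -- If z = ∂w, then σz - ∂σw lies in the kernel of `f` and has the same boundary as σz.
  -- Anticommutation turns minus its image under `φ` into a chain bounding φ∂σz.
  refine (ModuleCat.homologyClass_eq_zero_iff M 0 _).2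
    ⟨-Φ.φ 2 (Φ.σ 3 z - (C.d 4 3).hom (Φ.σ 4 w)), ?_⟩
  rw [map_neg, ← Φ.φ_d 1 _ (by rw [map_sub, Φ.map_σ, Φ.map_d_σ, hw, sub_self]), map_sub,
    ModuleCat.d_d_apply, sub_zero]
  rfl

/-- Cycles of `C` with a chain of `D` whose boundary is the image of the cycle. -/
def relCycles (_ : ShiftedComparison f M) : Submodule R (C.X 2 × D.X 3) where
  carrier := {x | (C.d 2 1).hom x.1 = 0 ∧ (f.f 2).hom x.1 = (D.d 3 2).hom x.2}
  add_mem' hx hy := by simp [hx.1, hx.2, hy.1, hy.2]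
  zero_mem' := by simp
  smul_mem' c x hx := by simp [hx.1, hx.2]

/-- The comparison on relative cycles. -/
noncomputable def relCyclesAux : Φ.relCycles →ₗ[R] M.homology 1 :=
  ModuleCat.homologyClass M 0 ∘ₗ LinearMap.codRestrict (LinearMap.ker (M.d 1 0).hom)
    (Φ.φ 1 ∘ₗ (LinearMap.fst R _ _ - (C.d 3 2).hom ∘ₗ Φ.σ 3 ∘ₗ LinearMap.snd R _ _) ∘ₗ
      Φ.relCycles.subtype) fun x => by
    refine Φ.φ_d_eq_zero 0 _ ?_ ?_
    · simp only [LinearMap.comp_apply, LinearMap.sub_apply, map_sub, Φ.map_d_σ]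
      exact sub_eq_zero.2 x.2.2
    · simp only [LinearMap.comp_apply, LinearMap.sub_apply, map_sub, ModuleCat.d_d_apply, sub_zero]
      exact x.2.1

/-- The class of the cycle underlying a relative cycle. -/
noncomputable def relCyclesClass (Φ : ShiftedComparison f M) : Φ.relCycles →ₗ[R]
    LinearMap.ker (HomologicalComplex.homologyMap f 2).hom :=
  LinearMap.codRestrict _ (ModuleCat.homologyClass C 1 ∘ₗ
    LinearMap.codRestrict (LinearMap.ker (C.d 2 1).hom)
      (LinearMap.fst R _ _ ∘ₗ Φ.relCycles.subtype) fun x => x.2.1) fun x => by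
    have hx : (D.d 2 1).hom ((f.f 2).hom x.1.1) = 0 := by rw [x.2.2, ModuleCat.d_d_apply]
    exact (ModuleCat.homologyClass_map f 1 _ ⟨_, hx⟩ rfl).trans
      ((ModuleCat.homologyClass_eq_zero_iff D 1 _).2 ⟨x.1.2, x.2.2.symm⟩)

/-- A class killed by `f` has a representing cycle whose image bounds; the bounding chain is the
second entry of the pair. -/
theorem relCyclesClass_surjective : Function.Surjective Φ.relCyclesClass := by
  rintro ⟨c, hc⟩
  obtain ⟨z, rfl⟩ := ModuleCat.homologyClass_surjective C 1 c
  have hz : (D.d 2 1).hom ((f.f 2).hom z.1) = 0 := by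
    rw [← ModuleCat.chainMap_d_apply, show (C.d 2 1).hom z.1 = 0 from z.2, map_zero]
  obtain ⟨w, hw⟩ := (ModuleCat.homologyClass_eq_zero_iff D 1 ⟨_, hz⟩).1
    ((ModuleCat.homologyClass_map f 1 z ⟨_, hz⟩ rfl).symm.trans hc)
  exact ⟨⟨(z.1, w), z.2, hw.symm⟩, Subtype.ext rfl⟩

/-- A pair (z, w) gives the cycle z - ∂σw of the kernel of `f`. Its class in H₁(M) depends on the
choice of w, but only up to the image of `d`. Surjectivity comes from lifting cycles of M along `φ`,
which `exists_d` allows. -/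
theorem exists_surjective (Φ : ShiftedComparison f M) : ∃ d : D.homology 3 →ₗ[R] M.homology 1,
    ∃ e : LinearMap.ker (HomologicalComplex.homologyMap f 2).hom →ₗ[R]
      (M.homology 1 ⧸ LinearMap.range d), Function.Surjective e := by
  obtain ⟨d, hd⟩ := Φ.exists_connecting
  refine ⟨d, ?_⟩
  obtain ⟨e, he⟩ := LinearMap.exists_comp_eq_of_surjective Φ.relCyclesClass
    ((LinearMap.range d).mkQ ∘ₗ Φ.relCyclesAux) Φ.relCyclesClass_surjective (by
      rintro ⟨⟨z, w⟩, hz, hw⟩ hx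
      obtain ⟨c, hc⟩ := (ModuleCat.homologyClass_eq_zero_iff C 1 _).1 (congrArg Subtype.val hx)
      change (C.d 3 2).hom c = z at hc
      change (f.f 2).hom z = (D.d 3 2).hom w at hw
      -- As z = ∂c, the chains w and f(c) have the same boundary. Their difference is the 3-cycle on
      -- which `d` gives the class of the pair, up to sign.
      have hζ : (D.d 3 2).hom (w - (f.f 3).hom c) = 0 := by
        rw [map_sub, ← hw, ← ModuleCat.chainMap_d_apply, hc, sub_self]
      refine (Submodule.Quotient.mk_eq_zero _).2
        ⟨-ModuleCat.homologyClass D 2 ⟨_, hζ⟩, ?_⟩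
      rw [map_neg, hd, neg_eq_iff_add_eq_zero, connectingAux, relCyclesAux, LinearMap.comp_apply,
        LinearMap.comp_apply, ← map_add, ModuleCat.homologyClass_eq_zero_iff]
      -- The sum of the two cycles is φ∂ of c - σf(c), which lies in the kernel of `f`.
      refine ⟨-Φ.φ 2 (c - Φ.σ 3 ((f.f 3).hom c)), ?_⟩
      rw [map_neg, ← Φ.φ_d 1 _ (by rw [map_sub, Φ.map_σ, sub_self])]
      change _ = Φ.φ 1 ((C.d 3 2).hom (Φ.σ 3 (w - (f.f 3).hom c))) +
        Φ.φ 1 (z - (C.d 3 2).hom (Φ.σ 3 w))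
      rw [← hc]
      simp only [map_sub]
      abel)
  refine ⟨e, fun c => ?_⟩
  obtain ⟨c, rfl⟩ := Submodule.Quotient.mk_surjective _ c
  obtain ⟨m, rfl⟩ := ModuleCat.homologyClass_surjective M 0 c
  obtain ⟨y, hy, hm⟩ := Φ.exists_φ 1 m.1
  -- Here φ∂y = -∂m = 0, so ∂y is also the boundary of some y' killed by `f` and `φ`. Then y - y' is
  -- a cycle still mapped to m.
  obtain ⟨y', h1, h2, h3⟩ := Φ.exists_d ((C.d 2 1).hom y)
    (by rw [ModuleCat.chainMap_d_apply, hy, map_zero])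
    (by rw [Φ.φ_d 0 _ hy, hm, neg_eq_zero]; exact m.2)
  refine ⟨Φ.relCyclesClass ⟨(y - y', 0), ?_, ?_⟩, ?_⟩
  · change (C.d 2 1).hom (y - y') = 0
    rw [map_sub, h3, sub_self]
  · change (f.f 2).hom (y - y') = (D.d 3 2).hom 0
    rw [map_sub, hy, h1, sub_zero, map_zero]
  · rw [he]
    refine congrArg (Submodule.Quotient.mk ∘ ModuleCat.homologyClass M 0) (Subtype.ext ?_)
    change Φ.φ 1 (y - y' - (C.d 3 2).hom (Φ.σ 3 0)) = m
    rw [map_zero, map_zero, sub_zero, map_sub, h2, sub_zero, hm]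

/-- Through `q` the module T is H₀(M), hence H₁(ker f) by the comparison, and through `ω` the
cokernel of ∂ : C₂ → C₁ embeds in U. So this is the long exact sequence at H₂(D) and H₁(ker f), with
`rel` in the role of the map induced by the inclusion. -/
theorem exists_exact (Φ : ShiftedComparison f M) {T U : Type*} [AddCommGroup T] [Module R T] [AddCommGroup U] [Module R U] (rel : T →+ U)
    (q : M.X 0 →ₗ[R] T) (hq : ∀ t, ∃ m, q m = t) (hq' : ∀ m, q ((M.d 1 0).hom m) = 0)
    (hq'' : ∀ m, q m = 0 → ∃ m', (M.d 1 0).hom m' = m)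
    (ω : C.X 1 →ₗ[R] U) (hω : ∀ y, ω ((C.d 2 1).hom y) = 0)
    (hω' : ∀ x, ω x = 0 → ∃ y, (C.d 2 1).hom y = x)
    (h : ∀ x, (f.f 1).hom x = 0 → rel (q (Φ.φ 0 x)) = ω x) :
    ∃ δ : D.homology 2 →+ T,
      Function.Exact (HomologicalComplex.homologyMap f 2).hom δ ∧ Function.Exact δ rel := by
  have hb : ∀ y : C.X 2, (f.f 2).hom y = 0 → q (Φ.φ 0 ((C.d 2 1).hom y)) = 0 := fun y hy => by
    rw [Φ.φ_d 0 y hy, map_neg, hq', neg_zero]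
  obtain ⟨δ, hδ⟩ := LinearMap.exists_comp_eq_of_surjective (ModuleCat.homologyClass D 1)
    (q ∘ₗ Φ.φ 0 ∘ₗ (C.d 2 1).hom ∘ₗ Φ.σ 2 ∘ₗ (LinearMap.ker (D.d 2 1).hom).subtype)
    (ModuleCat.homologyClass_surjective D 1) fun z hz => by
      obtain ⟨w, hw⟩ := (ModuleCat.homologyClass_eq_zero_iff D 1 z).1 hz
      have := hb (Φ.σ 2 z - (C.d 3 2).hom (Φ.σ 3 w))
        (by rw [map_sub, Φ.map_σ, Φ.map_d_σ, hw, sub_self])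
      rwa [map_sub (C.d 2 1).hom, ModuleCat.d_d_apply, sub_zero] at this
  replace hδ : ∀ z, δ (ModuleCat.homologyClass D 1 z) = q (Φ.φ 0 ((C.d 2 1).hom (Φ.σ 2 z))) := hδ
  have hker : ∀ z : LinearMap.ker (D.d 2 1).hom, (f.f 1).hom ((C.d 2 1).hom (Φ.σ 2 z)) = 0 :=
    fun z => (Φ.map_d_σ 1 z).trans z.2
  -- Any lift of f(c) may replace σf(c), since two lifts differ by an element of the kernel of `f`.
  have hf : ∀ c : C.X 2, q (Φ.φ 0 ((C.d 2 1).hom (Φ.σ 2 ((f.f 2).hom c)))) =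
      q (Φ.φ 0 ((C.d 2 1).hom c)) := fun c => by
    rw [← sub_eq_zero, ← map_sub, ← map_sub, ← map_sub]
    exact hb _ (by rw [map_sub, Φ.map_σ, sub_self])
  refine ⟨δ.toAddMonoidHom, fun x => ⟨fun hx => ?_, ?_⟩, fun t => ⟨fun ht => ?_, ?_⟩⟩
  · obtain ⟨z, rfl⟩ := ModuleCat.homologyClass_surjective D 1 x
    obtain ⟨m, hm⟩ := hq'' _ ((hδ z).symm.trans hx)
    obtain ⟨y, hy, rfl⟩ := Φ.exists_φ 1 m
    -- Since φ∂y = -∂φy cancels φ∂σz, the sum of the two boundaries is ∂y' with y' in the kernel of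
    -- `f`. Thus σz + y - y' is a cycle of C over z.
    obtain ⟨y', h1, -, h3⟩ := Φ.exists_d ((C.d 2 1).hom (Φ.σ 2 z) + (C.d 2 1).hom y)
      (by rw [map_add, hker, ModuleCat.chainMap_d_apply, hy, map_zero, add_zero])
      (by rw [map_add, Φ.φ_d 0 _ hy, hm, add_neg_cancel])
    have hc : (C.d 2 1).hom (Φ.σ 2 z + y - y') = 0 := by
      rw [map_sub, map_add, h3, sub_self]
    exact ⟨ModuleCat.homologyClass C 1 ⟨_, hc⟩, ModuleCat.homologyClass_map f 1 _ z
      (by simp only [map_sub, map_add, Φ.map_σ, hy, h1, add_zero, sub_zero])⟩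
  · rintro ⟨c, rfl⟩
    obtain ⟨z, rfl⟩ := ModuleCat.homologyClass_surjective C 1 c
    have hz : (D.d 2 1).hom ((f.f 2).hom z.1) = 0 := by
      rw [← ModuleCat.chainMap_d_apply, show (C.d 2 1).hom z.1 = 0 from z.2, map_zero]
    refine (congrArg δ (ModuleCat.homologyClass_map f 1 z ⟨_, hz⟩ rfl)).trans ?_
    rw [hδ, hf, show (C.d 2 1).hom z.1 = 0 from z.2, map_zero, map_zero]
  · obtain ⟨m, rfl⟩ := hq t
    obtain ⟨x, hx, rfl⟩ := Φ.exists_φ 0 m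
    -- The chain x of the kernel of `f` bounds in C, say x = ∂y. Then f(y) is a cycle, and y serves
    -- as its lift in computing δ.
    obtain ⟨y, rfl⟩ := hω' x ((h x hx).symm.trans ht)
    have hz : (D.d 2 1).hom ((f.f 2).hom y) = 0 := by
      rw [← ModuleCat.chainMap_d_apply, hx]
    exact ⟨ModuleCat.homologyClass D 1 ⟨_, hz⟩, (hδ _).trans (hf y)⟩
  · rintro ⟨c, rfl⟩
    obtain ⟨z, rfl⟩ := ModuleCat.homologyClass_surjective D 1 c
    refine (congrArg rel (hδ z)).trans ?_
    rw [h _ (hker z), hω]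

end ShiftedComparison

end ShiftedComparison

/-! ### Elements and differentials of total complexes of modules. -/

section TotalComplex

namespace ModuleCat

variable {R : Type u} [Ring R]
  (B : HomologicalComplex₂ (ModuleCat.{w} R) (ComplexShape.down ℕ) (ComplexShape.down ℕ))
  [B.HasTotal (ComplexShape.down ℕ)]

/-- The inclusion of the component `(p, q)` in the total complex. -/
noncomputable def totalι (p q n : ℕ) (h : p + q = n) :
    (B.X p).X q →ₗ[R] (B.total (ComplexShape.down ℕ)).X n :=
  (B.ιTotal (ComplexShape.down ℕ) p q n h).hom

/-- The linear map on a term of the total complex with given components. -/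
noncomputable def totalLift {n : ℕ} {A : Type w} [AddCommGroup A] [Module R A]
    (g : ∀ p q, p + q = n → (B.X p).X q →ₗ[R] A) :
    (B.total (ComplexShape.down ℕ)).X n →ₗ[R] A :=
  (B.totalDesc (A := ModuleCat.of R A) (c₁₂ := ComplexShape.down ℕ) (i₁₂ := n)
    fun p q h => ModuleCat.ofHom (g p q h)).hom

theorem totalLift_ι {n : ℕ} {A : Type w} [AddCommGroup A] [Module R A]
    (g : ∀ p q, p + q = n → (B.X p).X q →ₗ[R] A) (p q : ℕ) (h : p + q = n) (x : (B.X p).X q) :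
    totalLift B g (totalι B p q n h x) = g p q h x := by
  rw [totalLift, totalι, ← LinearMap.comp_apply, ← ModuleCat.hom_comp,
    HomologicalComplex₂.ι_totalDesc]
  rfl

theorem total_linearMap_ext {n : ℕ} {A : Type w} [AddCommGroup A] [Module R A]
    {g g' : (B.total (ComplexShape.down ℕ)).X n →ₗ[R] A}
    (h : ∀ p q (hpq : p + q = n) x, g (totalι B p q n hpq x) = g' (totalι B p q n hpq x)) :
    g = g' := by
  have : ModuleCat.ofHom g = ModuleCat.ofHom g' :=
    HomologicalComplex₂.total.hom_ext _ fun p q hpq =>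
      ModuleCat.hom_ext (LinearMap.ext fun x => h p q hpq x)
  exact congrArg ModuleCat.Hom.hom this

/-- The extensionality principle for maps, applied to the quotient map by `S`. -/
theorem total_mem_of_ι {n : ℕ} (S : Submodule R ((B.total (ComplexShape.down ℕ)).X n))
    (h : ∀ p q (hpq : p + q = n) x, totalι B p q n hpq x ∈ S)
    (x : (B.total (ComplexShape.down ℕ)).X n) : x ∈ S := by
  have : S.mkQ = 0 := total_linearMap_ext B fun p q hpq x =>
    (Submodule.Quotient.mk_eq_zero _).2 (h p q hpq x)
  exact (Submodule.Quotient.mk_eq_zero _).1 (LinearMap.congr_fun this x)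

theorem total_d_hom (n : ℕ) : ((B.total (ComplexShape.down ℕ)).d (n + 1) n).hom =
    (B.D₁ (ComplexShape.down ℕ) (n + 1) n).hom + (B.D₂ (ComplexShape.down ℕ) (n + 1) n).hom :=
  rfl

theorem D₁_ι_zero (q n : ℕ) (h : 0 + q = n + 1) (x : (B.X 0).X q) :
    (B.D₁ (ComplexShape.down ℕ) (n + 1) n).hom (totalι B 0 q (n + 1) h x) = 0 := by
  have : B.ιTotal (ComplexShape.down ℕ) 0 q (n + 1) h ≫ B.D₁ (ComplexShape.down ℕ) (n + 1) n = 0 := by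
    rw [HomologicalComplex₂.ι_D₁, HomologicalComplex₂.d₁_eq_zero]
    simp
  exact congrArg (fun φ => φ.hom x) this

theorem D₁_ι_succ (p q n : ℕ) (h : p + 1 + q = n + 1) (x : (B.X (p + 1)).X q) :
    (B.D₁ (ComplexShape.down ℕ) (n + 1) n).hom (totalι B (p + 1) q (n + 1) h x) =
      totalι B p q n (by lia) (((B.d (p + 1) p).f q).hom x) := by
  have : B.ιTotal (ComplexShape.down ℕ) (p + 1) q (n + 1) h ≫
      B.D₁ (ComplexShape.down ℕ) (n + 1) n =
      (B.d (p + 1) p).f q ≫ B.ιTotal (ComplexShape.down ℕ) p q n (show p + q = n by lia) := by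
    rw [HomologicalComplex₂.ι_D₁, HomologicalComplex₂.d₁_eq B (ComplexShape.down ℕ) rfl q n
      (show p + q = n by lia)]
    exact one_smul ℤˣ _
  exact congrArg (fun φ => φ.hom x) this

theorem D₂_ι_zero (p n : ℕ) (h : p + 0 = n + 1) (x : (B.X p).X 0) :
    (B.D₂ (ComplexShape.down ℕ) (n + 1) n).hom (totalι B p 0 (n + 1) h x) = 0 := by
  have : B.ιTotal (ComplexShape.down ℕ) p 0 (n + 1) h ≫ B.D₂ (ComplexShape.down ℕ) (n + 1) n = 0 := by
    rw [HomologicalComplex₂.ι_D₂, HomologicalComplex₂.d₂_eq_zero]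
    simp
  exact congrArg (fun φ => φ.hom x) this

theorem D₂_ι_succ (p q n : ℕ) (h : p + (q + 1) = n + 1) (x : (B.X p).X (q + 1)) :
    (B.D₂ (ComplexShape.down ℕ) (n + 1) n).hom (totalι B p (q + 1) (n + 1) h x) =
      (-1 : ℤ) ^ p • totalι B p q n (by lia) (((B.X p).d (q + 1) q).hom x) := by
  have : B.ιTotal (ComplexShape.down ℕ) p (q + 1) (n + 1) h ≫
      B.D₂ (ComplexShape.down ℕ) (n + 1) n =
      (-1 : ℤ) ^ p • ((B.X p).d (q + 1) q ≫
        B.ιTotal (ComplexShape.down ℕ) p q n (show p + q = n by lia)) := by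
    rw [HomologicalComplex₂.ι_D₂, HomologicalComplex₂.d₂_eq B (ComplexShape.down ℕ) p rfl n
      (show p + q = n by lia)]
    change (((-1 : ℤˣ) ^ p : ℤˣ)) • _ = _
    rw [Units.smul_def]
    push_cast
    rfl
  exact congrArg (fun φ => φ.hom x) this

/-- The projection of the total complex to the component `(a, b)`. -/
noncomputable def totalProj (a b n : ℕ) (h : a + b = n) :
    (B.total (ComplexShape.down ℕ)).X n →ₗ[R] (B.X a).X b :=
  totalLift B fun p q hpq => if hp : p = a then
    have hq : q = b := by lia
    hp ▸ hq ▸ LinearMap.id else 0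

theorem totalProj_ι (a b n : ℕ) (h : a + b = n) (x : (B.X a).X b) :
    totalProj B a b n h (totalι B a b n h x) = x := by
  rw [totalProj, totalLift_ι, dif_pos rfl]
  rfl

theorem totalProj_ι_of_ne (a b n : ℕ) (h : a + b = n) (p q : ℕ) (hpq : p + q = n) (hp : p ≠ a)
    (x : (B.X p).X q) : totalProj B a b n h (totalι B p q n hpq x) = 0 := by
  rw [totalProj, totalLift_ι, dif_neg hp]
  rfl

theorem total_map_ι {B B' : HomologicalComplex₂ (ModuleCat.{w} R) (ComplexShape.down ℕ)
    (ComplexShape.down ℕ)} [B.HasTotal (ComplexShape.down ℕ)] [B'.HasTotal (ComplexShape.down ℕ)]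
    (f : B ⟶ B') (p q n : ℕ) (h : p + q = n) (x : (B.X p).X q) :
    ((HomologicalComplex₂.total.map f (ComplexShape.down ℕ)).f n).hom (totalι B p q n h x) =
      totalι B' p q n h (((f.f p).f q).hom x) := by
  have := HomologicalComplex₂.ιTotal_map _ _ f (ComplexShape.down ℕ) p q n h
  exact congrArg (fun φ => φ.hom x) this

end ModuleCat

end TotalComplex

set_option linter.unusedSectionVars false

/-! ### From a comparison of bicomplexes to one of total complexes. -/

section BicomplexComparison

open ModuleCat

variable {R : Type u} [Ring R]
  {B B' : HomologicalComplex₂ (ModuleCat.{w} R) (ComplexShape.down ℕ) (ComplexShape.down ℕ)}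
  [B.HasTotal (ComplexShape.down ℕ)] [B'.HasTotal (ComplexShape.down ℕ)]

/-- A map of degree `(0, -1)` from `B` to `M` with the properties which give a
`ShiftedComparison` of the total complexes. -/
structure BicomplexComparison (f : B ⟶ B')
    (M : HomologicalComplex₂ (ModuleCat.{w} R) (ComplexShape.down ℕ) (ComplexShape.down ℕ)) where
  /-- a section in each bidegree -/
  σ (p q : ℕ) : (B'.X p).X q →ₗ[R] (B.X p).X q
  map_σ (p q : ℕ) (x : (B'.X p).X q) : ((f.f p).f q).hom (σ p q x) = x
  /-- the map of degree `(0, -1)` -/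
  Φ (p q : ℕ) : (B.X p).X (q + 1) →ₗ[R] (M.X p).X q
  Φ_dv (p q : ℕ) (x : (B.X p).X (q + 2)) (hx : ((f.f p).f (q + 2)).hom x = 0) :
    Φ p q (((B.X p).d (q + 2) (q + 1)).hom x) = -((M.X p).d (q + 1) q).hom (Φ p (q + 1) x)
  Φ_dh (p q : ℕ) (x : (B.X (p + 1)).X (q + 1)) (hx : ((f.f (p + 1)).f (q + 1)).hom x = 0) :
    Φ p q (((B.d (p + 1) p).f (q + 1)).hom x) = ((M.d (p + 1) p).f q).hom (Φ (p + 1) q x)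
  eq_zero (p : ℕ) (x : (B.X p).X 0) (hx : ((f.f p).f 0).hom x = 0) : x = 0
  exists_Φ (p q : ℕ) (m : (M.X p).X q) : ∃ y, ((f.f p).f (q + 1)).hom y = 0 ∧ Φ p q y = m
  exists_dv (x : (B.X 0).X 1) (hx : ((f.f 0).f 1).hom x = 0) (hx' : Φ 0 0 x = 0) :
    ∃ y : (B.X 0).X 2, ((f.f 0).f 2).hom y = 0 ∧ Φ 0 1 y = 0 ∧ ((B.X 0).d 2 1).hom y = x

namespace BicomplexComparison

variable {f : B ⟶ B'}
  {M : HomologicalComplex₂ (ModuleCat.{w} R) (ComplexShape.down ℕ) (ComplexShape.down ℕ)}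
  [M.HasTotal (ComplexShape.down ℕ)] (K : BicomplexComparison f M)

/-- The section on total complexes. -/
noncomputable def totalσ (n : ℕ) : (B'.total (ComplexShape.down ℕ)).X n →ₗ[R]
    (B.total (ComplexShape.down ℕ)).X n :=
  totalLift B' fun p q h => totalι B p q n h ∘ₗ K.σ p q

theorem totalσ_ι (p q n : ℕ) (h : p + q = n) (x : (B'.X p).X q) :
    K.totalσ n (totalι B' p q n h x) = totalι B p q n h (K.σ p q x) :=
  totalLift_ι B' _ p q h x

theorem map_totalσ (n : ℕ) (x : (B'.total (ComplexShape.down ℕ)).X n) :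
    ((HomologicalComplex₂.total.map f (ComplexShape.down ℕ)).f n).hom (K.totalσ n x) = x := by
  have : ((HomologicalComplex₂.total.map f (ComplexShape.down ℕ)).f n).hom ∘ₗ K.totalσ n =
      LinearMap.id := total_linearMap_ext B' fun p q h x => by
    rw [LinearMap.comp_apply, totalσ_ι, total_map_ι, K.map_σ]; rfl
  exact LinearMap.congr_fun this x

/-- An element of the kernel equals its image under id - σf. This operator acts separately on each
component, with values in the kernel there. -/
theorem ker_induction {n : ℕ} {S : Submodule R ((B.total (ComplexShape.down ℕ)).X n)}
    (K : BicomplexComparison f M)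
    (h : ∀ p q (hpq : p + q = n) x, ((f.f p).f q).hom x = 0 → totalι B p q n hpq x ∈ S)
    (x : (B.total (ComplexShape.down ℕ)).X n)
    (hx : ((HomologicalComplex₂.total.map f (ComplexShape.down ℕ)).f n).hom x = 0) : x ∈ S := by
  have := total_mem_of_ι B (S.comap (LinearMap.id - K.totalσ n ∘ₗ
    ((HomologicalComplex₂.total.map f (ComplexShape.down ℕ)).f n).hom)) (fun p q hpq x => by
      rw [Submodule.mem_comap, LinearMap.sub_apply, LinearMap.comp_apply, total_map_ι, totalσ_ι,
        LinearMap.id_apply, ← map_sub]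
      exact h p q hpq _ (by rw [map_sub, K.map_σ, sub_self])) x
  rw [Submodule.mem_comap, LinearMap.sub_apply, LinearMap.comp_apply, hx, map_zero, sub_zero] at this
  exact this

/-- The components of the map of degree `-1` on total complexes. -/
noncomputable def totalΦAux (n : ℕ) : ∀ p q, p + q = n + 1 →
    ((B.X p).X q →ₗ[R] (M.total (ComplexShape.down ℕ)).X n)
  | _, 0, _ => 0
  | p, q + 1, h => (-1 : ℤ) ^ p • (totalι M p q n (by lia) ∘ₗ K.Φ p q)

/-- The map of degree `-1` on total complexes. -/
noncomputable def totalΦ (n : ℕ) : (B.total (ComplexShape.down ℕ)).X (n + 1) →ₗ[R]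
    (M.total (ComplexShape.down ℕ)).X n :=
  totalLift B (K.totalΦAux n)

theorem totalΦ_ι_zero (p n : ℕ) (h : p + 0 = n + 1) (x : (B.X p).X 0) :
    K.totalΦ n (totalι B p 0 (n + 1) h x) = 0 :=
  totalLift_ι B _ p 0 h x

theorem totalΦ_ι (p q n : ℕ) (h : p + (q + 1) = n + 1) (x : (B.X p).X (q + 1)) :
    K.totalΦ n (totalι B p (q + 1) (n + 1) h x) =
      (-1 : ℤ) ^ p • totalι M p q n (by lia) (K.Φ p q x) :=
  totalLift_ι B _ p (q + 1) h x

/-- `Φ` commutes with the horizontal differential; the factor (-1)^p in `totalΦ` changes sign from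
one column to the next and makes it anticommute. The vertical differential stays in its column, so
there the anticommutation of `Φ` is unaffected. -/
theorem totalΦ_D₁ (p q n : ℕ) (h : p + q = n + 2) (x : (B.X p).X q)
    (hx : ((f.f p).f q).hom x = 0) :
    K.totalΦ n ((B.D₁ (ComplexShape.down ℕ) (n + 2) (n + 1)).hom (totalι B p q (n + 2) h x)) =
      -(M.D₁ (ComplexShape.down ℕ) (n + 1) n).hom
        (K.totalΦ (n + 1) (totalι B p q (n + 2) h x)) := by
  cases q with
  | zero => rw [K.eq_zero p x hx]; simp
  | succ q =>
    rw [totalΦ_ι, map_zsmul]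
    cases p with
    | zero => rw [D₁_ι_zero, D₁_ι_zero, map_zero, smul_zero, neg_zero]
    | succ p =>
      rw [D₁_ι_succ, D₁_ι_succ, totalΦ_ι, K.Φ_dh p q x hx, pow_succ]
      simp

theorem totalΦ_D₂ (p q n : ℕ) (h : p + q = n + 2) (x : (B.X p).X q)
    (hx : ((f.f p).f q).hom x = 0) :
    K.totalΦ n ((B.D₂ (ComplexShape.down ℕ) (n + 2) (n + 1)).hom (totalι B p q (n + 2) h x)) =
      -(M.D₂ (ComplexShape.down ℕ) (n + 1) n).hom
        (K.totalΦ (n + 1) (totalι B p q (n + 2) h x)) := by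
  match q, x, h, hx with
  | 0, x, h, hx => rw [K.eq_zero p x hx]; simp
  -- Both sides vanish: on the left the boundary lands in row zero, where the map of degree -1 is
  -- zero; on the right the image lies in row zero, where there is no vertical differential.
  | 1, x, h, hx =>
    rw [totalΦ_ι, map_zsmul, D₂_ι_zero, D₂_ι_succ, map_zsmul, totalΦ_ι_zero, smul_zero, neg_zero]
  | q + 2, x, h, hx =>
    rw [totalΦ_ι, map_zsmul, D₂_ι_succ, D₂_ι_succ, map_zsmul, totalΦ_ι, K.Φ_dv p q x hx, map_neg,
      smul_neg, smul_neg]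

/-- The comparison of total complexes. -/
noncomputable def shiftedComparison :
    ShiftedComparison (HomologicalComplex₂.total.map f (ComplexShape.down ℕ))
      (M.total (ComplexShape.down ℕ)) where
  σ := K.totalσ
  map_σ := K.map_totalσ
  φ := K.totalΦ
  φ_d n x hx := by
    have := K.ker_induction (S := LinearMap.ker (K.totalΦ n ∘ₗ
      ((B.total (ComplexShape.down ℕ)).d (n + 2) (n + 1)).hom +
      ((M.total (ComplexShape.down ℕ)).d (n + 1) n).hom ∘ₗ K.totalΦ (n + 1)))
      (fun p q h x hx => by
        rw [LinearMap.mem_ker, LinearMap.add_apply, LinearMap.comp_apply, LinearMap.comp_apply,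
          total_d_hom, total_d_hom, LinearMap.add_apply, LinearMap.add_apply, map_add,
          K.totalΦ_D₁ p q n h x hx, K.totalΦ_D₂ p q n h x hx]
        abel) x hx
    exact eq_neg_of_add_eq_zero_left this
  exists_φ n m := by
    refine total_mem_of_ι M ((LinearMap.ker ((HomologicalComplex₂.total.map f
      (ComplexShape.down ℕ)).f (n + 1)).hom).map (K.totalΦ n)) (fun p q h x => ?_) m
    obtain ⟨y, hy, rfl⟩ := K.exists_Φ p q x
    refine ⟨(-1 : ℤ) ^ p • totalι B p (q + 1) (n + 1) (by lia) y, ?_, ?_⟩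
    · rw [SetLike.mem_coe, LinearMap.mem_ker, map_zsmul, total_map_ι, hy, map_zero, smul_zero]
    · rw [map_zsmul, totalΦ_ι, smul_smul, ← mul_pow]
      simp
  -- The kernel of `f` has no part in row zero, so in total degree one it lives in bidegree (0, 1).
  -- The bounding chain is taken in column zero, where the horizontal differential is zero.
  exists_d x hx hx' := by
    obtain ⟨b, hb, rfl⟩ := K.ker_induction (S := (LinearMap.ker ((f.f 0).f 1).hom).map
      (totalι B 0 1 1 rfl)) (fun p q h x hx => by
        match p, q, x, h, hx with
        | 0, 1, x, h, hx => exact ⟨x, hx, rfl⟩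
        | 1, 0, x, h, hx =>
          rw [K.eq_zero 1 x hx, map_zero]
          exact Submodule.zero_mem _
        | 0, 0, x, h, hx => exact absurd h (by lia)
        | 0, q + 2, x, h, hx => exact absurd h (by lia)
        | 1, q + 1, x, h, hx => exact absurd h (by lia)
        | p + 2, q, x, h, hx => exact absurd h (by lia)) x hx
    have hΦ : K.Φ 0 0 b = 0 := by
      have h1 := congrArg (totalProj M 0 0 0 rfl) hx'
      rw [totalΦ_ι, map_zsmul, totalProj_ι, map_zero] at h1
      simpa using h1
    obtain ⟨y, h1, h2, h3⟩ := K.exists_dv b hb hΦ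
    refine ⟨totalι B 0 2 2 rfl y, ?_, ?_, ?_⟩
    · rw [total_map_ι, h1, map_zero]
    · rw [totalΦ_ι, h2, map_zero, smul_zero]
    · rw [total_d_hom, LinearMap.add_apply, D₁_ι_zero, D₂_ι_succ, h3]
      simp

end BicomplexComparison

end BicomplexComparison

/-! ### The degree-lowering map on bar chains and its restriction to the kernel. -/

section BarShift

variable {N : Type u} [Group N] {N'' : Type u} [Group N''] {R : Type v} {A : Type w}
  [AddCommGroup R] [AddCommGroup A]

/-- The map `(g₀, …, gₙ) ⊗ r ↦ (π g₁, …, π gₙ) ⊗ ε(r) κ(g₀)`. -/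
noncomputable def barShift (π : N →* N'') (ε : R →ₗ[ℤ] ℤ) (κ : N → A) (n : ℕ) :
    ((Fin (n + 1) → N) →₀ R) →ₗ[ℤ] ((Fin n → N'') →₀ A) :=
  Finsupp.lsum ℤ fun g => Finsupp.lsingle (fun i => π (g i.succ)) ∘ₗ
    LinearMap.toSpanSingleton ℤ A (κ (g 0)) ∘ₗ ε

theorem barShift_single (π : N →* N'') (ε : R →ₗ[ℤ] ℤ) (κ : N → A) (n : ℕ)
    (g : Fin (n + 1) → N) (r : R) : barShift π ε κ n (Finsupp.single g r) =
      Finsupp.single (fun i => π (g i.succ)) (ε r • κ (g 0)) := by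
  simp [barShift, -zsmul_eq_mul]

/-- The section of `barMap` given by a set-theoretic section of the group homomorphism. -/
noncomputable def barSection (R : Type v) [AddCommGroup R] {π : N →* N''}
    (hπ : Function.Surjective π) (n : ℕ) :
    ((Fin n → N'') →₀ R) →ₗ[ℤ] ((Fin n → N) →₀ R) :=
  Finsupp.lsum ℤ fun g => Finsupp.lsingle fun i => Function.surjInv hπ (g i)

theorem barSection_single {π : N →* N''} (hπ : Function.Surjective π) (n : ℕ)
    (g : Fin n → N'') (r : R) : barSection R hπ n (Finsupp.single g r) =
      Finsupp.single (fun i => Function.surjInv hπ (g i)) r := by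
  simp [barSection]

theorem barMap_barSection {π : N →* N''} (hπ : Function.Surjective π) (n : ℕ)
    (x : (Fin n → N'') →₀ R) : barMap π LinearMap.id n (barSection R hπ n x) = x := by
  have : barMap π LinearMap.id n ∘ₗ barSection R hπ n = LinearMap.id :=
    Finsupp.lhom_ext fun g r => by
      simp [barSection_single, barMap_single, Function.surjInv_eq hπ]
  exact LinearMap.congr_fun this x

/-- A linear map which only depends on images under `π` vanishes on the kernel of `barMap π`. -/
theorem eq_zero_of_barMap_eq_zero {π : N →* N''} (hπ : Function.Surjective π) {n : ℕ}
    {P : Type*} [AddCommGroup P] (F : ((Fin n → N) →₀ R) →ₗ[ℤ] P)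
    (h : ∀ g g' r, (∀ i, π (g i) = π (g' i)) → F (Finsupp.single g r) = F (Finsupp.single g' r))
    {x : (Fin n → N) →₀ R} (hx : barMap π LinearMap.id n x = 0) : F x = 0 := by
  have : F = F ∘ₗ barSection R hπ n ∘ₗ barMap π LinearMap.id n :=
    Finsupp.lhom_ext fun g r => by
      simp only [LinearMap.comp_apply, barMap_single, barSection_single]
      exact h _ _ _ fun i => (Function.surjInv_eq hπ _).symm
  rw [this, LinearMap.comp_apply, LinearMap.comp_apply, hx, map_zero, map_zero]

theorem barMap_zero_injective {π : N →* N''} (hπ : Function.Surjective π)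
    {x : (Fin 0 → N) →₀ R} (hx : barMap π LinearMap.id 0 x = 0) : x = 0 :=
  eq_zero_of_barMap_eq_zero hπ LinearMap.id
    (fun g g' _ _ => by rw [Subsingleton.elim g g']) hx

/-- Faces that leave g₀ alone cancel between the two summands. What remains is dropping g₀,
multiplying g₀ into g₁, and dropping πg₁ after the shift, which are the three terms on the right. -/
theorem barShift_barD_single (ρ : Representation ℤ N R) (hρ : ∀ g r, ρ g r = r)
    (ρ'' : Representation ℤ N'' A) (π : N →* N'') (ε : R →ₗ[ℤ] ℤ) (κ : N → A) (n : ℕ)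
    (g : Fin (n + 2) → N) (r : R) :
    barShift π ε κ n (barD ρ (n + 1) (Finsupp.single g r)) +
      barD ρ'' n (barShift π ε κ (n + 1) (Finsupp.single g r)) =
    Finsupp.single (fun i : Fin n => π (g i.succ.succ))
      (ε r • (κ (g 1) - κ (g 0 * g 1) + ρ'' (π (g 1))⁻¹ (κ (g 0)))) := by
  have h1 : ∀ j : Fin (n + 1), (fun i : Fin n =>
      π ((Fin.contractNth j.succ (· * ·) g : Fin (n + 1) → N) i.succ)) =
        Fin.contractNth j (· * ·) (fun i => π (g i.succ)) := fun j => by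
    funext i
    have := congrFun (Fin.comp_contractNth (· * ·) (· * ·) (f := π) (map_mul π) j
      (fun i => g i.succ)) i
    refine Eq.trans ?_ this
    simp only [Function.comp_apply, Fin.contractNth, Fin.val_succ, add_lt_add_iff_right,
      add_left_inj, Fin.succ_castSucc]
  have h2 : ∀ j : Fin (n + 1), (Fin.contractNth j.succ (· * ·) g : Fin (n + 1) → N) 0 = g 0 :=
    fun j => by simp [Fin.contractNth]
  have h3 : (fun i : Fin n => π ((Fin.contractNth 0 (· * ·) g : Fin (n + 1) → N) i.succ)) =
      fun i : Fin n => π (g i.succ.succ) := by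
    funext i; simp [Fin.contractNth]
  have h4 : (Fin.contractNth 0 (· * ·) g : Fin (n + 1) → N) 0 = g 0 * g 1 := by
    simp [Fin.contractNth]
  rw [barShift_single, barD_single, barD_single, hρ, map_add, map_sum, barShift_single,
    Fin.sum_univ_succ]
  simp only [map_zsmul, barShift_single, h1, h2, h3, h4, Fin.val_zero, Fin.val_succ, pow_succ,
    Fin.succ_zero_eq_one, smul_add, smul_sub, Finsupp.single_add, Finsupp.single_sub, mul_neg,
    mul_one, neg_smul, Finset.sum_neg_distrib, pow_zero, one_smul, neg_neg, map_neg]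
  abel

/-- The hypothesis on `κ` says that the error term just computed depends only on images under `π`,
so it disappears on the kernel. -/
theorem barShift_barD {ρ : Representation ℤ N R} (hρ : ∀ g r, ρ g r = r)
    {ρ'' : Representation ℤ N'' A} {π : N →* N''} (hπ : Function.Surjective π) (ε : R →ₗ[ℤ] ℤ)
    {κ : N → A} (hκ : ∀ a a' b b', π a = π a' → π b = π b' →
      κ b - κ (a * b) + ρ'' (π b)⁻¹ (κ a) = κ b' - κ (a' * b') + ρ'' (π b')⁻¹ (κ a'))
    (n : ℕ) {x : (Fin (n + 2) → N) →₀ R} (hx : barMap π LinearMap.id (n + 2) x = 0) :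
    barShift π ε κ n (barD ρ (n + 1) x) = -barD ρ'' n (barShift π ε κ (n + 1) x) :=
  eq_neg_of_add_eq_zero_left <| eq_zero_of_barMap_eq_zero hπ
    (barShift π ε κ n ∘ₗ barD ρ (n + 1) + barD ρ'' n ∘ₗ barShift π ε κ (n + 1))
    (fun g g' r h => by
      have h01 := hκ _ _ _ _ (h 0) (h 1)
      rw [h 1] at h01
      simp only [LinearMap.add_apply, LinearMap.comp_apply, barShift_barD_single ρ hρ, h, h01]) hx

/-- Naturality on the kernel does not need `κ` to be natural: its defect need only depend on images
under `π`. -/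
theorem barShift_barMap {N₁ N₁'' : Type u} [Group N₁] [Group N₁''] {R₁ : Type v} {A₁ : Type w}
    [AddCommGroup R₁] [AddCommGroup A₁] {π : N →* N''} (hπ : Function.Surjective π)
    {π₁ : N₁ →* N₁''} (d : N →* N₁) (d'' : N'' →* N₁'') (hd : ∀ g, π₁ (d g) = d'' (π g))
    {ε : R →ₗ[ℤ] ℤ} {ε₁ : R₁ →ₗ[ℤ] ℤ} (dR : R →ₗ[ℤ] R₁) (hR : ∀ r, ε₁ (dR r) = ε r)
    {κ : N → A} {κ₁ : N₁ → A₁} (dA : A →ₗ[ℤ] A₁)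
    (hκ : ∀ a a', π a = π a' → κ₁ (d a) - dA (κ a) = κ₁ (d a') - dA (κ a'))
    (n : ℕ) {x : (Fin (n + 1) → N) →₀ R} (hx : barMap π LinearMap.id (n + 1) x = 0) :
    barShift π₁ ε₁ κ₁ n (barMap d dR (n + 1) x) = barMap d'' dA n (barShift π ε κ n x) :=
  sub_eq_zero.1 <| eq_zero_of_barMap_eq_zero hπ
    (barShift π₁ ε₁ κ₁ n ∘ₗ barMap d dR (n + 1) - barMap d'' dA n ∘ₗ barShift π ε κ n)
    (fun g g' r h => by
      simp only [LinearMap.sub_apply, LinearMap.comp_apply, barShift_single, barMap_single, h, hd,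
        hR, ← Finsupp.single_sub, map_zsmul, ← smul_sub, hκ _ _ (h 0)]) hx

theorem exists_barShift {π : N →* N''} (hπ : Function.Surjective π) {ε : R →ₗ[ℤ] ℤ} {e : R}
    (he : ε e = 1) {κ : N → A} (hκ : ∀ a, ∃ k k', π k = π k' ∧ κ k - κ k' = a) (n : ℕ)
    (m : (Fin n → N'') →₀ A) :
    ∃ y, barMap π (LinearMap.id : R →ₗ[ℤ] R) (n + 1) y = 0 ∧ barShift π ε κ n y = m := by
  induction m using Finsupp.induction_linear with
  | zero => exact ⟨0, map_zero _, map_zero _⟩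
  | add m m' h h' =>
    obtain ⟨y, h1, h2⟩ := h
    obtain ⟨y', h3, h4⟩ := h'
    exact ⟨y + y', by rw [map_add, h1, h3, add_zero], by rw [map_add, h2, h4]⟩
  | single g a =>
    obtain ⟨k, k', hk, rfl⟩ := hκ a
    let s : Fin n → N := fun i => Function.surjInv hπ (g i)
    -- The two tuples have the same image under `π`, and their shifts differ in the coefficient κ(k)
    -- - κ(k') = a.
    refine ⟨Finsupp.single (Fin.cons k s : Fin (n + 1) → N) e -
      Finsupp.single (Fin.cons k' s : Fin (n + 1) → N) e, ?_, ?_⟩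
    · have : (fun i => π ((Fin.cons k s : Fin (n + 1) → N) i)) =
          fun i => π ((Fin.cons k' s : Fin (n + 1) → N) i) := by
        funext i
        refine Fin.cases hk (fun i => rfl) i
      rw [map_sub, barMap_single, barMap_single, this, sub_self]
    · simp [barShift_single, he, ← Finsupp.single_sub, s, Function.surjInv_eq hπ]

theorem barD_single_one {ρ : Representation ℤ N R} (hρ : ∀ g r, ρ g r = r) (a b : N) (r : R) :
    barD ρ 1 (Finsupp.single ![a, b] r) = Finsupp.single (fun _ => b) r -
      Finsupp.single (fun _ => a * b) r + Finsupp.single (fun _ => a) r := by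
  have h0 : (fun i : Fin 1 => (![a, b] : Fin 2 → N) i.succ) = fun _ => b := by
    funext i; fin_cases i; rfl
  have h1 : ((0 : Fin 2).contractNth (· * ·) ![a, b] : Fin 1 → N) = fun _ => a * b := by
    funext i; fin_cases i; simp [Fin.contractNth]
  have h2 : ((1 : Fin 2).contractNth (· * ·) ![a, b] : Fin 1 → N) = fun _ => a := by
    funext i; fin_cases i; simp [Fin.contractNth]
  rw [barD_single, Fin.sum_univ_two, h0, h1, h2, hρ]
  simp [sub_eq_add_neg, add_assoc]

/-- On the kernel of `barMap π` in degree one, `barShift` is the quotient map by boundaries of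
chains on which `barShift` vanishes. -/
theorem exists_barD_eq {ρ : Representation ℤ N R} (hρ : ∀ g r, ρ g r = r) {π : N →* N''}
    (hπ : Function.Surjective π) {ε : R →ₗ[ℤ] ℤ} (hε : Function.Injective ε) {e : R}
    (he : ε e = 1) {κ : N → A} {N' : Type u} [Group N'] (i : N' →* N) (cls : N' →* Multiplicative A)
    (hi : ∀ k, π (i k) = 1) (hex : ∀ g g', π g = π g' → ∃ k, g' = g * i k)
    (hκ : ∀ g k, κ (g * i k) = κ g + (cls k).toAdd) (hcls : Function.Surjective cls)
    (hker : cls.ker ≤ commutator N') {x : (Fin 1 → N) →₀ R}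
    (hx : barMap π LinearMap.id 1 x = 0) (hx' : barShift π ε κ 0 x = 0) :
    ∃ y : (Fin 2 → N) →₀ R,
      barMap π LinearMap.id 2 y = 0 ∧ barShift π ε κ 1 y = 0 ∧ barD ρ 1 y = x := by
  -- The goal becomes x ∈ L. On the kernel of `barMap π`, the quotient map by L will be shown to
  -- factor through `barShift`, which kills x.
  let L : Submodule ℤ ((Fin 1 → N) →₀ R) :=
    (LinearMap.ker (barMap π (LinearMap.id : R →ₗ[ℤ] R) 2) ⊓
      LinearMap.ker (barShift π ε κ 1)).map (barD ρ 1)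
  let c : N → ((Fin 1 → N) →₀ R) ⧸ L := fun g => L.mkQ (Finsupp.single (fun _ => g) e)
  have hc : ∀ g k, c (g * i k) - c g = c (i k) - c 1 := by
    intro g k
    -- The pairs [g, 1] and [g, i(k)] have the same image under `π` and the same first entry, so
    -- their difference is killed by `barMap π` and by `barShift`.
    have : L.mkQ (barD ρ 1 (Finsupp.single ![g, 1] e - Finsupp.single ![g, i k] e)) = 0 := by
      refine (Submodule.Quotient.mk_eq_zero _).2 ⟨_, ⟨?_, ?_⟩, rfl⟩
      · have : (fun j => π ((![g, 1] : Fin 2 → N) j)) =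
            fun j => π ((![g, i k] : Fin 2 → N) j) := by
          funext j; fin_cases j <;> simp [hi]
        rw [SetLike.mem_coe, LinearMap.mem_ker, map_sub, barMap_single, barMap_single, this,
          sub_self]
      · have : (fun j : Fin 1 => π ((![g, 1] : Fin 2 → N) j.succ)) =
            fun j : Fin 1 => π ((![g, i k] : Fin 2 → N) j.succ) := by
          funext j; fin_cases j; simp [hi]
        rw [SetLike.mem_coe, LinearMap.mem_ker, map_sub, barShift_single, barShift_single, this]
        simp
    rw [map_sub, barD_single_one hρ, barD_single_one hρ, mul_one] at this
    simp only [map_sub, map_add] at this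
    rw [sub_eq_sub_iff_add_eq_add, ← sub_eq_zero, ← this]
    simp only [c]
    abel
  let χ : N' →* Multiplicative (((Fin 1 → N) →₀ R) ⧸ L) :=
    { toFun k := Multiplicative.ofAdd (c (i k) - c 1)
      map_one' := by rw [map_one, sub_self]; rfl
      map_mul' k l := by
        rw [← ofAdd_add, map_mul, ← hc (i k) l]
        congr 1
        abel }
  have hχ : cls.ker ≤ χ.ker := hker.trans (Abelianization.commutator_subset_ker χ)
  -- Having an abelian target, χ kills commutators, hence the kernel of `cls`, and so descends to A.
  let ψ : A →+ ((Fin 1 → N) →₀ R) ⧸ L :=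
    AddMonoidHom.toMultiplicative.symm (cls.liftOfSurjective hcls ⟨χ, hχ⟩)
  have hψ : ∀ k, ψ (cls k).toAdd = c (i k) - c 1 := fun k =>
    MonoidHom.liftOfRightInverse_comp_apply cls _ (Function.rightInverse_surjInv hcls) ⟨χ, hχ⟩ k
  have hmk : ∀ g r, L.mkQ (Finsupp.single g r) = ε r • c (g 0) := fun g r => by
    have hr : r = ε r • e := hε (by rw [map_zsmul, he, smul_eq_mul, mul_one])
    have hg : g = fun _ => g 0 := funext fun j => by rw [Subsingleton.elim j 0]
    rw [← map_zsmul, Finsupp.smul_single, ← hr, ← hg]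
  -- Replacing g by g·i(k) changes the class of g and ψκ(g) by the same amount χ(k), so the
  -- difference depends only on πg.
  have hF := eq_zero_of_barMap_eq_zero hπ (L.mkQ -
    ψ.toIntLinearMap ∘ₗ Finsupp.lapply (fun j : Fin 0 => j.elim0) ∘ₗ barShift π ε κ 0)
    (fun g g' r h => by
      obtain ⟨k, hk⟩ := hex _ _ (h 0)
      have hs : ∀ g : Fin 1 → N, (fun j : Fin 0 => π (g j.succ)) = fun j : Fin 0 => j.elim0 :=
        fun g => Subsingleton.elim _ _
      simp only [LinearMap.sub_apply, LinearMap.comp_apply, barShift_single, hmk, hs,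
        Finsupp.lapply_apply, Finsupp.single_eq_same, AddMonoidHom.coe_toIntLinearMap, map_zsmul,
        ← smul_sub, hk, hκ, map_add, hψ, ← hc (g 0) k]
      congr 1
      abel) hx
  rw [LinearMap.sub_apply, LinearMap.comp_apply, LinearMap.comp_apply, hx', map_zero, map_zero,
    sub_zero] at hF
  obtain ⟨y, ⟨h1, h2⟩, h3⟩ := (Submodule.Quotient.mk_eq_zero _).1 hF
  exact ⟨y, h1, h2, h3⟩

end BarShift

namespace CrossedModule

/-! ### Simplices of the nerve and abelianisation of the nerve. -/

section NerveConstruction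

variable {H G : Type u} [Group H] [Group G] (X : CrossedModule H G)

/-- The simplex of the nerve with the arrows `(Pᵢ Pⱼ⁻¹, μ(Pⱼ) g)`. -/
def nerveMk {n : ℕ} (P : Fin (n + 1) → H) (g : G) : X.nerve n :=
  ⟨fun e => ⟨P e.1.1 * (P e.1.2)⁻¹, X.μ (P e.1.2) * g⟩, fun i j k hij hjk => by
    refine ⟨by simp [src_apply, tgt_apply], ?_⟩
    ext <;> simp [comp]⟩

/-- From x i n = x i j ∘ x j n: a simplex is determined by its arrows out of the last vertex and by
that vertex. -/
theorem nerve_left {n : ℕ} (x : X.nerve n) (i j : Fin (n + 1)) (h : i ≤ j) :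
    (x.1 (edge h)).left =
      (x.1 (edge (Fin.le_last i))).left * (x.1 (edge (Fin.le_last j))).left⁻¹ := by
  have := congrArg SemidirectProduct.left (x.2 i j (Fin.last n) h (Fin.le_last j)).2
  rw [this]
  simp [comp]

theorem nerve_right {n : ℕ} (x : X.nerve n) (i j : Fin (n + 1)) (h : i ≤ j) :
    (x.1 (edge h)).right = X.μ (x.1 (edge (Fin.le_last j))).left *
      (x.1 (edge (le_refl (Fin.last n)))).right := by
  have h1 := (x.2 i j (Fin.last n) h (Fin.le_last j)).1
  have h2 := congrArg SemidirectProduct.right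
    (x.2 j (Fin.last n) (Fin.last n) (Fin.le_last j) le_rfl).2
  rw [src_apply, tgt_apply, h2] at h1
  exact h1

theorem abNerve_fst {C A : Type w} [AddCommGroup C] [AddCommGroup A] {ν : C →+ A} {n : ℕ}
    (x : abNerve ν n) (i j : Fin (n + 1)) (h : i ≤ j) : (x.1 (edge h)).1 =
      (x.1 (edge (Fin.le_last i))).1 - (x.1 (edge (Fin.le_last j))).1 := by
  have := congrArg Prod.fst (x.2 i j (Fin.last n) h (Fin.le_last j)).2
  rw [this]
  simp

theorem abNerve_snd {C A : Type w} [AddCommGroup C] [AddCommGroup A] {ν : C →+ A} {n : ℕ}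
    (x : abNerve ν n) (i j : Fin (n + 1)) (h : i ≤ j) : (x.1 (edge h)).2 =
      ν (x.1 (edge (Fin.le_last j))).1 + (x.1 (edge (le_refl (Fin.last n)))).2 := by
  have h1 := (x.2 i j (Fin.last n) h (Fin.le_last j)).1
  have h2 := congrArg Prod.snd (x.2 j (Fin.last n) (Fin.last n) (Fin.le_last j) le_rfl).2
  rw [h2] at h1
  exact h1

/-- The homomorphism from the nerve of a crossed module to the nerve of its abelianisation. -/
def nerveAb (n : ℕ) : X.nerve n →* Multiplicative (abNerve X.ab n) where
  toFun x := Multiplicative.ofAdd ⟨fun e => (Additive.ofMul ((x.1 e).left : H ⧸ X.commH),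
      Additive.ofMul (Abelianization.of (x.1 e).right)), fun i j k hij hjk => by
    obtain ⟨h1, h2⟩ := x.2 i j k hij hjk
    rw [src_apply, tgt_apply] at h1
    refine ⟨?_, ?_⟩
    · simp only [h1, map_mul, ofMul_mul]
      rfl
    · simp only [h2]
      rfl⟩
  map_one' := rfl
  map_mul' x y := by
    refine Subtype.ext (funext fun e => Prod.ext ?_ ?_)
    · change Additive.ofMul (((x.1 e).left * X.act (x.1 e).right (y.1 e).left : H) : H ⧸ X.commH) =
        _
      rw [QuotientGroup.mk_mul, X.mk_act]
      rfl
    · rfl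

theorem nerveAb_nerveMap {m n : ℕ} (f : Fin (m + 1) →o Fin (n + 1)) (x : X.nerve n) :
    (X.nerveAb m (X.nerveMap f x)).toAdd = abNerveMap X.ab f (X.nerveAb n x).toAdd := rfl

/-- Only the arrows out of the last vertex and the vertex itself need lifting; `nerveMk` completes
the lifts to a simplex. -/
theorem nerveAb_surjective (n : ℕ) : Function.Surjective (X.nerveAb n) := by
  intro y
  choose P hP using fun j : Fin (n + 1) =>
    QuotientGroup.mk_surjective (y.toAdd.1 (edge (Fin.le_last j))).1.toMul
  obtain ⟨g, hg⟩ := QuotientGroup.mk_surjective (y.toAdd.1 (edge (le_refl (Fin.last n)))).2.toMul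
  refine ⟨X.nerveMk P g, Subtype.ext (funext fun ⟨⟨i, j⟩, h⟩ => Prod.ext ?_ ?_)⟩
  · refine Eq.trans ?_ (abNerve_fst y.toAdd i j h).symm
    change Additive.ofMul ((P i * (P j)⁻¹ : H) : H ⧸ X.commH) = _
    rw [QuotientGroup.mk_mul, QuotientGroup.mk_inv, hP, hP, sub_eq_add_neg]
    rfl
  · refine Eq.trans ?_ (abNerve_snd y.toAdd i j h).symm
    change Additive.ofMul (Abelianization.of (X.μ (P j) * g)) = _
    rw [map_mul, ← abMul_mk, hP, ofMul_mul]
    exact congrArg _ (congrArg Additive.ofMul hg)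

/-- The degenerate simplex on an object. -/
def nerveConst (n : ℕ) : G →* X.nerve n where
  toFun g := ⟨fun _ => SemidirectProduct.inr g, fun i j k hij hjk => by
    refine ⟨by simp [src_apply, tgt_apply], ?_⟩
    ext <;> simp [comp]⟩
  map_one' := rfl
  map_mul' g g' := Subtype.ext (funext fun _ => map_mul SemidirectProduct.inr g g')

theorem nerve_zero_eq (x : X.nerve 0) : x = X.nerveConst 0 (x.1 (edge (le_refl 0))).right := by
  refine Subtype.ext (funext fun ⟨⟨i, j⟩, h⟩ => ?_)
  obtain rfl := Subsingleton.elim (α := Fin 1) i 0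
  obtain rfl := Subsingleton.elim (α := Fin 1) j 0
  have := X.nerve_left x 0 0 le_rfl
  refine SemidirectProduct.ext ?_ rfl
  rw [this]
  exact mul_inv_cancel _

/-- A 0-simplex is a degenerate simplex on an element of G, and `nerveConst` carries commutators to
commutators. This is the only simplicial degree in which the kernel of `nerveAb` is needed. -/
theorem nerveAb_zero_ker_le : (X.nerveAb 0).ker ≤ commutator (X.nerve 0) := by
  intro x hx
  have h1 : Abelianization.of (x.1 (edge (le_refl 0))).right = 1 :=
    congrArg (fun y : Multiplicative (abNerve X.ab 0) => (y.toAdd.1 (edge (le_refl 0))).2.toMul) hx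
  have h2 : (x.1 (edge (le_refl 0))).right ∈ commutator G := (QuotientGroup.eq_one_iff _).1 h1
  rw [X.nerve_zero_eq x]
  have : commutator G ≤ (commutator (X.nerve 0)).comap (X.nerveConst 0) := by
    refine Subgroup.commutator_le.2 fun a _ b _ => ?_
    rw [Subgroup.mem_comap, map_commutatorElement]
    exact Subgroup.commutator_mem_commutator (Subgroup.mem_top _) (Subgroup.mem_top _)
  exact this h2

end NerveConstruction

/-! ### The nerve of the coefficients (0, ℤ, 0). -/

section IntegralCoefficients

/-- The identification of the nerve of `(0, ℤ, 0)` with `ℤ`. -/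
def abNerveInt (n : ℕ) : abNerve (0 : PUnit.{1} →+ ℤ) n →ₗ[ℤ] ℤ :=
  AddMonoidHom.toIntLinearMap
    { toFun x := (x.1 (edge (le_refl (Fin.last n)))).2
      map_zero' := rfl
      map_add' _ _ := rfl }

theorem abNerveInt_eq {n : ℕ} (x : abNerve (0 : PUnit.{1} →+ ℤ) n) (e : Edge n) :
    abNerveInt n x = (x.1 e).2 := by
  obtain ⟨⟨i, j⟩, h⟩ := e
  rw [abNerve_snd x i j h, AddMonoidHom.zero_apply, zero_add]
  rfl

theorem abNerveInt_injective (n : ℕ) : Function.Injective (abNerveInt n) := fun x y h =>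
  Subtype.ext (funext fun e => Prod.ext rfl
    ((abNerveInt_eq x e).symm.trans (h.trans (abNerveInt_eq y e))))

theorem abNerveInt_map {m n : ℕ} (f : Fin (m + 1) →o Fin (n + 1))
    (x : abNerve (0 : PUnit.{1} →+ ℤ) n) : abNerveInt m (abNerveMap _ f x) = abNerveInt n x :=
  (abNerveInt_eq x _).symm

/-- The generator of the nerve of `(0, ℤ, 0)`. -/
def abNerveOne (n : ℕ) : abNerve (0 : PUnit.{1} →+ ℤ) n :=
  ⟨fun _ => (0, 1), fun _ _ _ _ _ => ⟨by simp, by simp⟩⟩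

theorem abNerveInt_one (n : ℕ) : abNerveInt n (abNerveOne n) = 1 := rfl

theorem trivialAction_onNerve {H G : Type u} [Group H] [Group G] (X : CrossedModule H G)
    {C A : Type w} [AddCommGroup C] [AddCommGroup A] (ν : C →+ A) (n : ℕ) (g : X.nerve n)
    (r : abNerve ν n) : (trivialAction ν X).onNerve n g r = r := by
  refine Subtype.ext (funext fun e => ?_)
  change (trivialAction ν X).onArrows (g.1 e) (r.1 e) = r.1 e
  simp [Action.onArrows_apply, trivialAction]

end IntegralCoefficients

/-! ### Exactness on nerves and the cochain κ with values in the abelianised kernel. -/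

namespace ShortExact

variable {H' G' H G H'' G'' : Type u} [Group H'] [Group G'] [Group H] [Group G]
  [Group H''] [Group G''] {X' : CrossedModule H' G'} {X : CrossedModule H G}
  {X'' : CrossedModule H'' G''} {i : Hom X' X} {p : Hom X X''} (S : ShortExact i p)

theorem onNerve_injective (S : ShortExact i p) (n : ℕ) : Function.Injective (i.onNerve n) :=
  fun x y h => Subtype.ext (funext fun e => by
    have he := congrFun (congrArg Subtype.val h) e
    exact SemidirectProduct.ext (S.injective_H (congrArg SemidirectProduct.left he))
      (S.injective_G (congrArg SemidirectProduct.right he)))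

theorem onNerve_surjective (S : ShortExact i p) (n : ℕ) : Function.Surjective (p.onNerve n) := by
  intro y
  choose P hP using fun j : Fin (n + 1) => S.surjective_H (y.1 (edge (Fin.le_last j))).left
  obtain ⟨g, hg⟩ := S.surjective_G (y.1 (edge (le_refl (Fin.last n)))).right
  refine ⟨X.nerveMk P g, Subtype.ext (funext fun ⟨⟨i, j⟩, h⟩ => SemidirectProduct.ext ?_ ?_)⟩
  · refine Eq.trans ?_ (X''.nerve_left y i j h).symm
    change p.onH (P i * (P j)⁻¹) = _
    rw [map_mul, map_inv, hP, hP]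
  · refine Eq.trans ?_ (X''.nerve_right y i j h).symm
    change p.onG (X.μ (P j) * g) = _
    rw [map_mul, ← p.comm, hP, hg]

theorem onNerve_onNerve (S : ShortExact i p) (n : ℕ) (k : X'.nerve n) :
    p.onNerve n (i.onNerve n k) = 1 :=
  Subtype.ext (funext fun _ => SemidirectProduct.ext (S.onH_onH _) (S.onG_onG _))

/-- The arrows lift one at a time; injectivity of `i` then transports the relations of a simplex to
the lifts. -/
theorem exists_onNerve (S : ShortExact i p) {n : ℕ} {g : X.nerve n} (hg : p.onNerve n g = 1) :
    ∃ k, i.onNerve n k = g := by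
  have hl : ∀ e, ∃ m, i.onH m = (g.1 e).left := fun e => S.exists_onH
    (congrArg SemidirectProduct.left (congrFun (congrArg Subtype.val hg) e))
  have hr : ∀ e, ∃ l, i.onG l = (g.1 e).right := fun e => S.exists_onG
    (congrArg SemidirectProduct.right (congrFun (congrArg Subtype.val hg) e))
  choose m hm using hl
  choose l hl using hr
  refine ⟨⟨fun e => ⟨m e, l e⟩, fun a b c hab hbc => ⟨?_, ?_⟩⟩,
    Subtype.ext (funext fun e => SemidirectProduct.ext (hm e) (hl e))⟩
  · refine S.injective_G ?_
    have := (g.2 a b c hab hbc).1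
    rw [src_apply, tgt_apply] at this ⊢
    simpa [← i.comm, ← hm, ← hl] using this
  · have := (g.2 a b c hab hbc).2
    refine SemidirectProduct.ext (S.injective_H ?_) (S.injective_G ?_)
    · simpa [comp, ← hm] using congrArg SemidirectProduct.left this
    · simpa [comp, ← hl] using congrArg SemidirectProduct.right this

theorem exists_mul_onNerve (S : ShortExact i p) {n : ℕ} (g g' : X.nerve n)
    (h : p.onNerve n g = p.onNerve n g') : ∃ k, g' = g * i.onNerve n k := by
  obtain ⟨k, hk⟩ := S.exists_onNerve (g := g⁻¹ * g') (by simp [h])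
  exact ⟨k, by rw [hk, mul_inv_cancel_left]⟩

/-- Conjugating (m, l) by (h, g) in H ⋊ G gives H-component ᵘm · (h ᵛh⁻¹) with u = μ(h)g and v =
glg⁻¹. These factors are exactly the two terms in the action on arrows, the second being ξ. -/
theorem nerveAb_conj {n : ℕ} (g : X.nerve n) (k k' : X'.nerve n)
    (h : i.onNerve n k' = g * i.onNerve n k * g⁻¹) : (X'.nerveAb n k').toAdd =
      S.action.onNerve n (p.onNerve n g) (X'.nerveAb n k).toAdd := by
  refine Subtype.ext (funext fun e => ?_)
  change (Additive.ofMul ((k'.1 e).left : H' ⧸ X'.commH),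
    Additive.ofMul (Abelianization.of (k'.1 e).right)) =
      S.action.onArrows (p.onArrows (g.1 e)) (Additive.ofMul ((k.1 e).left : H' ⧸ X'.commH),
        Additive.ofMul (Abelianization.of (k.1 e).right))
  have he : i.onArrows (k'.1 e) = g.1 e * i.onArrows (k.1 e) * (g.1 e)⁻¹ :=
    congrFun (congrArg Subtype.val h) e
  have hr : (k'.1 e).right = S.conjG (g.1 e).right (k.1 e).right := S.injective_G (by
    rw [onG_conjG]
    exact congrArg SemidirectProduct.right he)
  have hl : (k'.1 e).left = S.conjH (X.μ (g.1 e).left * (g.1 e).right) (k.1 e).left *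
      S.xi (g.1 e).left (S.conjG (g.1 e).right (k.1 e).right) := S.injective_H (by
    rw [map_mul, onH_conjH, onH_xi, onG_conjG]
    have := congrArg SemidirectProduct.left he
    simpa [Hom.onArrows, X.peiffer, mul_assoc] using this)
  rw [Action.onArrows_apply, hr, hl]
  have h1 : (p.onArrows (g.1 e)).left = p.onH (g.1 e).left := rfl
  have h2 : (p.onArrows (g.1 e)).right = p.onG (g.1 e).right := rfl
  rw [h1, h2, p.comm, ← map_mul, S.action_actC, S.action_actA, S.action_ξ]
  rfl

/-- The class in the abelianisation of the difference between an element of the nerve and the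
chosen representative of its image. -/
noncomputable def nerveDiff (n : ℕ) (g : X.nerve n) : abNerve X'.ab n :=
  (X'.nerveAb n (S.exists_mul_onNerve (Function.surjInv (S.onNerve_surjective n) (p.onNerve n g)) g
    (Function.surjInv_eq _ _)).choose).toAdd

theorem nerveDiff_eq {n : ℕ} {g : X.nerve n} {k : X'.nerve n}
    (h : g = Function.surjInv (S.onNerve_surjective n) (p.onNerve n g) * i.onNerve n k) :
    S.nerveDiff n g = (X'.nerveAb n k).toAdd := by
  have h1 := (S.exists_mul_onNerve (Function.surjInv (S.onNerve_surjective n) (p.onNerve n g)) g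
    (Function.surjInv_eq _ _)).choose_spec
  exact congrArg (fun k => (X'.nerveAb n k).toAdd)
    (S.onNerve_injective n (mul_left_cancel (h1.symm.trans h)))

theorem nerveDiff_mul (n : ℕ) (g : X.nerve n) (k : X'.nerve n) :
    S.nerveDiff n (g * i.onNerve n k) = S.nerveDiff n g + (X'.nerveAb n k).toAdd := by
  obtain ⟨l, hl⟩ := S.exists_mul_onNerve
    (Function.surjInv (S.onNerve_surjective n) (p.onNerve n g)) g (Function.surjInv_eq _ _)
  rw [S.nerveDiff_eq hl, S.nerveDiff_eq (k := l * k), map_mul, toAdd_mul]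
  rw [map_mul (p.onNerve n), S.onNerve_onNerve, mul_one, map_mul, ← mul_assoc, ← hl]

/-- Move k past b: (ak)(bl) = ab·(b⁻¹kb)·l. The class of b⁻¹kb in κ(ab) is then cancelled by the
action of (πb)⁻¹ on the class of k in κ(a), and the class of l cancels as well. -/
theorem nerveDiff_cocycle (n : ℕ) (a a' b b' : X.nerve n) (ha : p.onNerve n a = p.onNerve n a')
    (hb : p.onNerve n b = p.onNerve n b') :
    S.nerveDiff n b - S.nerveDiff n (a * b) +
      S.action.onNerve n (p.onNerve n b)⁻¹ (S.nerveDiff n a) =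
    S.nerveDiff n b' - S.nerveDiff n (a' * b') +
      S.action.onNerve n (p.onNerve n b')⁻¹ (S.nerveDiff n a') := by
  obtain ⟨k, rfl⟩ := S.exists_mul_onNerve a a' ha
  obtain ⟨l, rfl⟩ := S.exists_mul_onNerve b b' hb
  obtain ⟨m, hm⟩ := S.exists_onNerve (g := b⁻¹ * i.onNerve n k * b)
    (by simp [S.onNerve_onNerve])
  have h1 : a * i.onNerve n k * (b * i.onNerve n l) = a * b * i.onNerve n m * i.onNerve n l := by
    rw [hm]; group
  have h2 := S.nerveAb_conj b m k (by rw [hm]; group)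
  rw [h1, ← hb]
  simp only [nerveDiff_mul, map_add, h2]
  rw [← Module.End.mul_apply, ← map_mul, inv_mul_cancel, map_one, Module.End.one_apply]
  abel

/-- The sections in different simplicial degrees are chosen independently, so κ need not be
simplicial. The classes of elements of the kernel are, so the defect does not change under right
multiplication by them. -/
theorem nerveDiff_nerveMap {m n : ℕ} (f : Fin (m + 1) →o Fin (n + 1)) (a a' : X.nerve n)
    (ha : p.onNerve n a = p.onNerve n a') :
    S.nerveDiff m (X.nerveMap f a) - abNerveMap X'.ab f (S.nerveDiff n a) =
      S.nerveDiff m (X.nerveMap f a') - abNerveMap X'.ab f (S.nerveDiff n a') := by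
  obtain ⟨k, rfl⟩ := S.exists_mul_onNerve a a' ha
  have : X.nerveMap f (i.onNerve n k) = i.onNerve m (X'.nerveMap f k) := rfl
  rw [map_mul, this, nerveDiff_mul, nerveDiff_mul, map_add, nerveAb_nerveMap]
  abel

end ShortExact

end CrossedModule

/-! ### The differentials of the bicomplex in coordinates. -/

theorem ModuleCat.sum_hom_apply {R : Type u} [Ring R] {P Q : ModuleCat.{w} R} {ι : Type*}
    (s : Finset ι) (f : ι → (P ⟶ Q)) (x : P) : (∑ i ∈ s, f i).hom x = ∑ i ∈ s, (f i).hom x := by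
  rw [ModuleCat.hom_sum, LinearMap.sum_apply]

namespace CrossedModule

section Bicomplex

variable {C A : Type w} [AddCommGroup C] [AddCommGroup A] {ν : C →+ A}
  {H G : Type u} [Group H] [Group G] {X : CrossedModule H G}

theorem bicomplex_d_f_apply (α : Action ν X) (n q : ℕ)
    (x : (Fin q → X.nerve (n + 1)) →₀ abNerve ν (n + 1)) :
    (((bicomplex α).d (n + 1) n).f q).hom x = ∑ i : Fin (n + 2), (-1 : ℤ) ^ (i : ℕ) •
      barMap (X.nerveMap (SimplexCategory.δ i).toOrderHom)
        (abNerveMap ν (SimplexCategory.δ i).toOrderHom) q x := by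
  have h1 : (bicomplex α).d (n + 1) n = ∑ i : Fin (n + 2), (-1 : ℤ) ^ (i : ℕ) •
      (simplicialChains α).δ i :=
    AlgebraicTopology.AlternatingFaceMapComplex.obj_d_eq (simplicialChains α) n
  have h2 : ((bicomplex α).d (n + 1) n).f q = ∑ i : Fin (n + 2), (-1 : ℤ) ^ (i : ℕ) •
      ((simplicialChains α).δ i).f q := by
    refine (congrArg (HomologicalComplex.Hom.fAddMonoidHom q) h1).trans ?_
    exact map_sum (HomologicalComplex.Hom.fAddMonoidHom q) _ _
  refine (congrArg (fun φ => ModuleCat.Hom.hom φ x) h2).trans ?_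
  exact ModuleCat.sum_hom_apply _ _ _

theorem bicomplex_X_d_apply (α : Action ν X) (p q : ℕ)
    (x : (Fin (q + 1) → X.nerve p) →₀ abNerve ν p) :
    (((bicomplex α).X p).d (q + 1) q).hom x = barD (α.onNerve p) q x := by
  have : ((bicomplex α).X p).d (q + 1) q = ModuleCat.ofHom (barD (α.onNerve p) q) :=
    barChains_d (α.onNerve p) q
  exact congrArg (fun φ => φ.hom x) this

end Bicomplex

/-! ### The comparison of bicomplexes for a short exact sequence. -/

namespace ShortExact

variable {H' G' H G H'' G'' : Type u} [Group H'] [Group G'] [Group H] [Group G]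
  [Group H''] [Group G''] {X' : CrossedModule H' G'} {X : CrossedModule H G}
  {X'' : CrossedModule H'' G''} {i : Hom X' X} {p : Hom X X''} (S : ShortExact i p)

theorem barShift_sum_barMap (n q : ℕ)
    {x : (Fin (q + 1) → X.nerve (n + 1)) →₀ abNerve (0 : PUnit.{1} →+ ℤ) (n + 1)}
    (hx : barMap (p.onNerve (n + 1)) LinearMap.id (q + 1) x = 0) :
    barShift (p.onNerve n) (abNerveInt n) (S.nerveDiff n) q
      (∑ i : Fin (n + 2), (-1 : ℤ) ^ (i : ℕ) •
        barMap (X.nerveMap (SimplexCategory.δ i).toOrderHom)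
          (abNerveMap (0 : PUnit.{1} →+ ℤ) (SimplexCategory.δ i).toOrderHom) (q + 1) x) =
    ∑ i : Fin (n + 2), (-1 : ℤ) ^ (i : ℕ) •
      barMap (X''.nerveMap (SimplexCategory.δ i).toOrderHom)
        (abNerveMap X'.ab (SimplexCategory.δ i).toOrderHom) q
        (barShift (p.onNerve (n + 1)) (abNerveInt (n + 1)) (S.nerveDiff (n + 1)) q x) := by
  rw [map_sum]
  refine Finset.sum_congr rfl fun j _ => ?_
  rw [map_zsmul, barShift_barMap (S.onNerve_surjective (n + 1)) (π₁ := p.onNerve n)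
    (X.nerveMap (SimplexCategory.δ j).toOrderHom)
    (X''.nerveMap (SimplexCategory.δ j).toOrderHom) (fun _ => rfl) _ (abNerveInt_map _)
    (abNerveMap X'.ab (SimplexCategory.δ j).toOrderHom) (S.nerveDiff_nerveMap _) q hx]

/-- The comparison of the kernel of the map of bicomplexes for integral homology with the
bicomplex with coefficients in the abelianisation of the kernel. -/
noncomputable def bicomplexComparison : BicomplexComparison
    ((AlgebraicTopology.alternatingFaceMapComplex _).map
      (simplicialChainsMap (trivialAction (0 : PUnit.{1} →+ ℤ) X'') p))
    (bicomplex S.action) where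
  σ n q := barSection _ (S.onNerve_surjective n) q
  map_σ n q x := barMap_barSection (S.onNerve_surjective n) q x
  Φ n q := barShift (p.onNerve n) (abNerveInt n) (S.nerveDiff n) q
  Φ_dv n q x hx := by
    have h := barShift_barD (trivialAction_onNerve X (0 : PUnit.{1} →+ ℤ) n)
      (S.onNerve_surjective n) (abNerveInt n) (S.nerveDiff_cocycle n) q (x := x) hx
    have h1 := bicomplex_X_d_apply (trivialAction (0 : PUnit.{1} →+ ℤ) X) n (q + 1) x
    have h2 := bicomplex_X_d_apply S.action n q
      (barShift (p.onNerve n) (abNerveInt n) (S.nerveDiff n) (q + 1) x)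
    exact (congrArg _ h1).trans (h.trans (congrArg Neg.neg h2.symm))
  Φ_dh n q x hx := by
    have h1 := bicomplex_d_f_apply (trivialAction (0 : PUnit.{1} →+ ℤ) X) n (q + 1) x
    have h2 := bicomplex_d_f_apply S.action n q
      (barShift (p.onNerve (n + 1)) (abNerveInt (n + 1)) (S.nerveDiff (n + 1)) q x)
    have h := S.barShift_sum_barMap n q (x := x) hx
    exact (congrArg _ h1).trans (h.trans h2.symm)
  eq_zero n x hx := barMap_zero_injective (S.onNerve_surjective n) hx
  -- Every class a occurs as κ(i(k)) - κ(1), with k in the nerve of `X'` representing a.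
  exists_Φ n q m := exists_barShift (S.onNerve_surjective n) (abNerveInt_one n) (fun a => by
    obtain ⟨k, rfl⟩ := X'.nerveAb_surjective n (Multiplicative.ofAdd a)
    exact ⟨1 * i.onNerve n k, 1, by rw [one_mul, S.onNerve_onNerve, map_one],
      by rw [S.nerveDiff_mul, add_sub_cancel_left]; rfl⟩) q m
  exists_dv x hx hx' := by
    obtain ⟨y, h1, h2, h3⟩ := exists_barD_eq (trivialAction_onNerve X _ 0) (S.onNerve_surjective 0)
      (abNerveInt_injective 0) (abNerveInt_one 0) (i.onNerve 0) (X'.nerveAb 0) (S.onNerve_onNerve 0)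
      S.exists_mul_onNerve (S.nerveDiff_mul 0) (X'.nerveAb_surjective 0) X'.nerveAb_zero_ker_le
      hx hx'
    exact ⟨y, h1, h2, (bicomplex_X_d_apply _ 0 1 y).trans h3⟩

end ShortExact

end CrossedModule

/-! ### Bar differentials and face sums in the lowest degrees. -/

section

variable {N : Type u} [Group N] {A : Type w} [AddCommGroup A]

theorem barD_zero_single (ρ : Representation ℤ N A) (g : Fin 1 → N) (a : A) :
    barD ρ 0 (Finsupp.single g a) = Finsupp.single default (ρ (g 0)⁻¹ a - a) := by
  rw [barD_single, Fin.sum_univ_one, Finsupp.single_sub, sub_eq_add_neg]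
  simp [Subsingleton.elim _ (default : Fin 0 → N)]

variable {N₁ : Type u} [Group N₁] {A₁ : Type w} [AddCommGroup A₁]

theorem sum_barMap_two (d : Fin 2 → (N →* N₁)) (δ : Fin 2 → (A →ₗ[ℤ] A₁)) (q : ℕ)
    (g : Fin q → N) (a : A) :
    ∑ i : Fin 2, (-1 : ℤ) ^ (i : ℕ) • barMap (d i) (δ i) q (Finsupp.single g a) =
      Finsupp.single (fun j => d 0 (g j)) (δ 0 a) -
        Finsupp.single (fun j => d 1 (g j)) (δ 1 a) := by
  rw [Fin.sum_univ_two, barMap_single, barMap_single]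
  simp [sub_eq_add_neg]

theorem sum_barMap_two_zero (d : Fin 2 → (N →* N₁)) (δ : Fin 2 → (A →ₗ[ℤ] A₁))
    (g : Fin 0 → N) (a : A) :
    ∑ i : Fin 2, (-1 : ℤ) ^ (i : ℕ) • barMap (d i) (δ i) 0 (Finsupp.single g a) =
      Finsupp.single default (δ 0 a - δ 1 a) := by
  rw [sum_barMap_two, Finsupp.single_sub]
  simp [Subsingleton.elim _ (default : Fin 0 → N₁)]

theorem sum_barMap_three_zero (d : Fin 3 → (N →* N₁)) (δ : Fin 3 → (A →ₗ[ℤ] A₁))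
    (g : Fin 0 → N) (a : A) :
    ∑ i : Fin 3, (-1 : ℤ) ^ (i : ℕ) • barMap (d i) (δ i) 0 (Finsupp.single g a) =
      Finsupp.single default (δ 0 a - δ 1 a + δ 2 a) := by
  rw [Fin.sum_univ_three, barMap_single, barMap_single, barMap_single, Finsupp.single_add,
    Finsupp.single_sub]
  simp [sub_eq_add_neg, Subsingleton.elim _ (default : Fin 0 → N₁)]

end

/-! ### Boundaries of generators of the total complex in degrees one and two. -/

namespace CrossedModule

open ModuleCat

section Bicomplex

variable {C A : Type w} [AddCommGroup C] [AddCommGroup A] {ν : C →+ A}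
  {H G : Type u} [Group H] [Group G] {X : CrossedModule H G} (α : Action ν X)

/-- The chain `(g₁, …, g_q) ⊗ a` in the total complex. -/
noncomputable def totSingle (p q n : ℕ) (h : p + q = n) (g : Fin q → X.nerve p) :
    abNerve ν p →ₗ[ℤ] (tot α).X n :=
  totalι (bicomplex α) p q n h ∘ₗ Finsupp.lsingle (R := ℤ) (M := abNerve ν p) g

theorem tot_linearMap_ext {n : ℕ} {P : Type (max u w)} [AddCommGroup P]
    {F F' : (tot α).X n →ₗ[ℤ] P}
    (h : ∀ p q (hpq : p + q = n) g a,
      F (totSingle α p q n hpq g a) = F' (totSingle α p q n hpq g a)) : F = F' :=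
  total_linearMap_ext (bicomplex α) fun p q hpq x => by
    have : F ∘ₗ totalι (bicomplex α) p q n hpq = F' ∘ₗ totalι (bicomplex α) p q n hpq :=
      Finsupp.lhom_ext (M := abNerve ν p) fun g a => h p q hpq g a
    exact LinearMap.congr_fun this x

/-- Additive maps make the choice of ℤ-module structure on the target immaterial, which suits
targets that are quotients of terms of the complex. -/
theorem tot_addMonoidHom_ext {n : ℕ} {P : Type (max u w)} [AddCommGroup P]
    {F F' : (tot α).X n →+ P}
    (h : ∀ p q (hpq : p + q = n) g a,
      F (totSingle α p q n hpq g a) = F' (totSingle α p q n hpq g a)) : F = F' := by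
  let L (F : (tot α).X n →+ P) : (tot α).X n →ₗ[ℤ] P :=
    { F with map_smul' := fun c x => map_intCast_smul F ℤ ℤ c x }
  have : L F = L F' := tot_linearMap_ext α h
  exact AddMonoidHom.ext fun x => LinearMap.congr_fun this x

/-- The boundary of a chain in the column zero. -/
theorem tot_d_zero_one (g : Fin 1 → X.nerve 0) (a : abNerve ν 0) :
    ((tot α).d 1 0).hom (totSingle α 0 1 1 rfl g a) =
      totSingle α 0 0 0 rfl default (α.onNerve 0 (g 0)⁻¹ a - a) := by
  change (((bicomplex α).total (ComplexShape.down ℕ)).d (0 + 1) 0).hom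
    (totalι (bicomplex α) 0 (0 + 1) (0 + 1) rfl _) = _
  rw [total_d_hom, LinearMap.add_apply, D₁_ι_zero, D₂_ι_succ, zero_add, pow_zero, one_smul]
  exact congrArg _ ((bicomplex_X_d_apply α 0 0 _).trans (barD_zero_single _ g a))

theorem tot_d_one_zero (g : Fin 0 → X.nerve 1) (a : abNerve ν 1) :
    ((tot α).d 1 0).hom (totSingle α 1 0 1 rfl g a) =
      totSingle α 0 0 0 rfl default (abNerveMap ν (SimplexCategory.δ 0).toOrderHom a -
        abNerveMap ν (SimplexCategory.δ 1).toOrderHom a) := by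
  change (((bicomplex α).total (ComplexShape.down ℕ)).d (0 + 1) 0).hom
    (totalι (bicomplex α) (0 + 1) 0 (0 + 1) rfl _) = _
  rw [total_d_hom, LinearMap.add_apply, D₁_ι_succ, D₂_ι_zero, add_zero]
  exact congrArg _ ((bicomplex_d_f_apply α 0 0 _).trans (sum_barMap_two_zero _ _ g a))

theorem tot_d_two_zero (g : Fin 0 → X.nerve 2) (a : abNerve ν 2) :
    ((tot α).d 2 1).hom (totSingle α 2 0 2 rfl g a) =
      totSingle α 1 0 1 rfl default (abNerveMap ν (SimplexCategory.δ 0).toOrderHom a -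
        abNerveMap ν (SimplexCategory.δ 1).toOrderHom a +
        abNerveMap ν (SimplexCategory.δ 2).toOrderHom a) := by
  change (((bicomplex α).total (ComplexShape.down ℕ)).d (1 + 1) 1).hom
    (totalι (bicomplex α) (1 + 1) 0 (1 + 1) rfl _) = _
  rw [total_d_hom, LinearMap.add_apply, D₁_ι_succ, D₂_ι_zero, add_zero]
  exact congrArg _ ((bicomplex_d_f_apply α 1 0 _).trans (sum_barMap_three_zero _ _ g a))

theorem tot_d_one_one (g : Fin 1 → X.nerve 1) (a : abNerve ν 1) :
    ((tot α).d 2 1).hom (totSingle α 1 1 2 rfl g a) =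
      totSingle α 0 1 1 rfl (fun j => X.nerveMap (SimplexCategory.δ 0).toOrderHom (g j))
        (abNerveMap ν (SimplexCategory.δ 0).toOrderHom a) -
      totSingle α 0 1 1 rfl (fun j => X.nerveMap (SimplexCategory.δ 1).toOrderHom (g j))
        (abNerveMap ν (SimplexCategory.δ 1).toOrderHom a) -
      totSingle α 1 0 1 rfl default (α.onNerve 1 (g 0)⁻¹ a - a) := by
  have h1 : (((bicomplex α).d 1 0).f 1).hom (Finsupp.lsingle (R := ℤ) (M := abNerve ν 1) g a) =
      Finsupp.lsingle (R := ℤ) (M := abNerve ν 0)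
        (fun j => X.nerveMap (SimplexCategory.δ 0).toOrderHom (g j))
        (abNerveMap ν (SimplexCategory.δ 0).toOrderHom a) -
      Finsupp.lsingle (R := ℤ) (M := abNerve ν 0)
        (fun j => X.nerveMap (SimplexCategory.δ 1).toOrderHom (g j))
        (abNerveMap ν (SimplexCategory.δ 1).toOrderHom a) :=
    (bicomplex_d_f_apply α 0 1 _).trans (sum_barMap_two _ _ 1 g a)
  have h2 : (((bicomplex α).X 1).d 1 0).hom (Finsupp.lsingle (R := ℤ) (M := abNerve ν 1) g a) =
      Finsupp.lsingle (R := ℤ) (M := abNerve ν 1) default (α.onNerve 1 (g 0)⁻¹ a - a) :=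
    (bicomplex_X_d_apply α 1 0 _).trans (barD_zero_single _ g a)
  change (((bicomplex α).total (ComplexShape.down ℕ)).d (1 + 1) 1).hom
    (totalι (bicomplex α) (0 + 1) (0 + 1) (1 + 1) rfl _) = _
  rw [total_d_hom, LinearMap.add_apply, D₁_ι_succ, D₂_ι_succ]
  refine (congrArg₂ (· + (-1 : ℤ) ^ 1 • ·) ((congrArg _ h1).trans
    (map_sub (totalι (bicomplex α) 0 1 1 rfl) _ _))
    (congrArg _ h2)).trans ?_
  have h3 : ∀ y z : (tot α).X 1, y + (-1 : ℤ) ^ 1 • z = y - z := fun y z => by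
    rw [pow_one, neg_one_zsmul, sub_eq_add_neg]
  exact h3 _ _

theorem tot_d_zero_two (hα : ∀ g a, α.onNerve 0 g a = a) (g : Fin 2 → X.nerve 0)
    (a : abNerve ν 0) : ((tot α).d 2 1).hom (totSingle α 0 2 2 rfl g a) =
      totSingle α 0 1 1 rfl (fun _ => g 1) a - totSingle α 0 1 1 rfl (fun _ => g 0 * g 1) a +
        totSingle α 0 1 1 rfl (fun _ => g 0) a := by
  have h : (((bicomplex α).X 0).d 2 1).hom (Finsupp.lsingle (R := ℤ) (M := abNerve ν 0) g a) =
      Finsupp.lsingle (R := ℤ) (M := abNerve ν 0) (fun _ => g 1) a -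
      Finsupp.lsingle (R := ℤ) (M := abNerve ν 0) (fun _ => g 0 * g 1) a +
      Finsupp.lsingle (R := ℤ) (M := abNerve ν 0) (fun _ => g 0) a := by
    refine (bicomplex_X_d_apply α 0 1 _).trans ?_
    have hg : g = ![g 0, g 1] := by funext j; fin_cases j <;> rfl
    conv_lhs => rw [hg]
    exact barD_single_one hα (g 0) (g 1) a
  change (((bicomplex α).total (ComplexShape.down ℕ)).d (1 + 1) 1).hom
    (totalι (bicomplex α) 0 (1 + 1) (1 + 1) rfl _) = _
  rw [total_d_hom, LinearMap.add_apply, D₁_ι_zero, D₂_ι_succ, zero_add, pow_zero, one_smul]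
  exact (congrArg _ h).trans ((map_add (totalι (bicomplex α) 0 1 1 rfl) _ _).trans
    (congrArg (· + _) (map_sub (totalι (bicomplex α) 0 1 1 rfl) _ _)))

/-- The vertex of a `0`-simplex. -/
def vertex (X : CrossedModule H G) : X.nerve 0 →* G where
  toFun x := (x.1 (edge (le_refl 0))).right
  map_one' := rfl
  map_mul' _ _ := rfl

theorem nerveConst_vertex (x : X.nerve 0) : X.nerveConst 0 (X.vertex x) = x :=
  (X.nerve_zero_eq x).symm

/-- The vertex of a `0`-simplex of the nerve of an abelian crossed module. -/
def abVertex (ν : C →+ A) : abNerve ν 0 →ₗ[ℤ] A :=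
  AddMonoidHom.toIntLinearMap
    { toFun x := (x.1 (edge (le_refl 0))).2
      map_zero' := rfl
      map_add' _ _ := rfl }

/-- The two vertices of a `1`-simplex. -/
theorem vertex_δ_one (x : X.nerve 1) :
    X.vertex (X.nerveMap (SimplexCategory.δ 1).toOrderHom x) =
      X.μ (x.1 (edge (Fin.le_last 0))).left *
        X.vertex (X.nerveMap (SimplexCategory.δ 0).toOrderHom x) := by
  have h0 := X.nerve_right x 0 0 le_rfl
  exact h0

theorem abVertex_δ_one (x : abNerve ν 1) :
    abVertex ν (abNerveMap ν (SimplexCategory.δ 1).toOrderHom x) =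
      ν (x.1 (edge (Fin.le_last 0))).1 +
        abVertex ν (abNerveMap ν (SimplexCategory.δ 0).toOrderHom x) :=
  abNerve_snd x 0 0 le_rfl

end Bicomplex

end CrossedModule

namespace CrossedModule

open ModuleCat

section Bicomplex

variable {C A : Type w} [AddCommGroup C] [AddCommGroup A] {ν : C →+ A}
  {H G : Type u} [Group H] [Group G] {X : CrossedModule H G} (α : Action ν X)

/-- The linear map on a term of the total complex which is given on one component and vanishes
on the others. -/
noncomputable def totComponent {P : Type*} [AddCommGroup P] (p q n : ℕ) (h : p + q = n)
    (F : (Fin q → X.nerve p) → abNerve ν p →ₗ[ℤ] P) : (tot α).X n →ₗ[ℤ] P :=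
  Finsupp.lsum ℤ F ∘ₗ totalProj (bicomplex α) p q n h

theorem totComponent_single {P : Type*} [AddCommGroup P] (p q n : ℕ) (h : p + q = n)
    (F : (Fin q → X.nerve p) → abNerve ν p →ₗ[ℤ] P) (g : Fin q → X.nerve p) (a : abNerve ν p) :
    totComponent α p q n h F (totSingle α p q n h g a) = F g a := by
  have h1 : totalProj (bicomplex α) p q n h (totSingle α p q n h g a) = Finsupp.single g a :=
    totalProj_ι _ _ _ _ _ _
  have h2 : Finsupp.lsum ℤ F (Finsupp.single g a) = F g a := Finsupp.lsum_single _ _ _ _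
  exact (congrArg _ h1).trans h2

theorem totComponent_single_of_ne {P : Type*} [AddCommGroup P] (p q n : ℕ) (h : p + q = n)
    (F : (Fin q → X.nerve p) → abNerve ν p →ₗ[ℤ] P) (p' q' : ℕ) (h' : p' + q' = n) (hp : p' ≠ p)
    (g : Fin q' → X.nerve p') (a : abNerve ν p') :
    totComponent α p q n h F (totSingle α p' q' n h' g a) = 0 := by
  have h1 : totalProj (bicomplex α) p q n h (totSingle α p' q' n h' g a) = 0 :=
    totalProj_ι_of_ne _ _ _ _ _ _ _ _ hp _
  exact (congrArg (Finsupp.lsum ℤ F) h1).trans (map_zero (Finsupp.lsum ℤ F))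

end Bicomplex

section NerveMk

variable {H G : Type u} [Group H] [Group G] (X : CrossedModule H G)

/-- The simplex is the arrow (h, 1) from 1 to μ(h); δ₁ keeps vertex 0, which is the target. -/
theorem nerveMap_δ_one_nerveMk (h : H) :
    X.nerveMap (SimplexCategory.δ 1).toOrderHom (X.nerveMk ![h, 1] 1) =
      X.nerveConst 0 (X.μ h) := by
  rw [← X.nerveConst_vertex (X.nerveMap _ _), vertex_δ_one]
  congr 1
  change X.μ (h * (1 : H)⁻¹) * (X.μ 1 * 1) = X.μ h
  simp

theorem nerveMap_δ_zero_nerveMk (h : H) :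
    X.nerveMap (SimplexCategory.δ 0).toOrderHom (X.nerveMk ![h, 1] 1) = 1 := by
  rw [← X.nerveConst_vertex (X.nerveMap _ _)]
  have : X.vertex (X.nerveMap (SimplexCategory.δ 0).toOrderHom (X.nerveMk ![h, 1] 1)) = 1 := by
    change X.μ 1 * 1 = 1
    simp
  rw [this, map_one]

end NerveMk

/-! ### Integral 1-chains modulo boundaries and G/(μ(H)[G, G]). -/

section FirstHomology

variable {H G : Type u} [Group H] [Group G] (X : CrossedModule H G)

/-- The quotient `G/(μ(H) [G, G])` is commutative. -/
@[reducible] def commGroupMuComm : CommGroup (G ⧸ X.muComm) :=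
  { (inferInstance : Group (G ⧸ X.muComm)) with
    mul_comm := by
      intro a b
      obtain ⟨a, rfl⟩ := QuotientGroup.mk_surjective a
      obtain ⟨b, rfl⟩ := QuotientGroup.mk_surjective b
      rw [← QuotientGroup.mk_mul, ← QuotientGroup.mk_mul, QuotientGroup.eq]
      refine Subgroup.mem_sup_right ?_
      have := Subgroup.commutator_mem_commutator (Subgroup.mem_top b⁻¹) (Subgroup.mem_top a⁻¹)
      simpa [commutatorElement_def, mul_assoc, commutator_def] using this }

attribute [local instance] commGroupMuComm

/-- The map from chains of degree one to `G/(μ(H) [G, G])`. -/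
noncomputable def toQuot : (tot (trivialAction (0 : PUnit.{1} →+ ℤ) X)).X 1 →ₗ[ℤ]
    Additive (G ⧸ X.muComm) :=
  totComponent _ 0 1 1 rfl fun g => LinearMap.toSpanSingleton ℤ _
    (Additive.ofMul (X.vertex (g 0) : G ⧸ X.muComm)) ∘ₗ abNerveInt 0

theorem toQuot_zero_one (g : Fin 1 → X.nerve 0) (r : abNerve (0 : PUnit.{1} →+ ℤ) 0) :
    X.toQuot (totSingle _ 0 1 1 rfl g r) =
      abNerveInt 0 r • Additive.ofMul (X.vertex (g 0) : G ⧸ X.muComm) :=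
  totComponent_single _ _ _ _ _ _ _ _

theorem toQuot_one_zero (g : Fin 0 → X.nerve 1) (r : abNerve (0 : PUnit.{1} →+ ℤ) 1) :
    X.toQuot (totSingle _ 1 0 1 rfl g r) = 0 :=
  totComponent_single_of_ne _ _ _ _ _ _ _ _ _ one_ne_zero _ _

theorem mk_vertex_δ (x : X.nerve 1) :
    (X.vertex (X.nerveMap (SimplexCategory.δ 1).toOrderHom x) : G ⧸ X.muComm) =
      X.vertex (X.nerveMap (SimplexCategory.δ 0).toOrderHom x) := by
  rw [vertex_δ_one, QuotientGroup.mk_mul,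
    (QuotientGroup.eq_one_iff (N := X.muComm) _).2 (Subgroup.mem_sup_left ⟨_, rfl⟩), one_mul]

/-- Bidegree (0, 2) gives the relation that products become sums, (1, 1) the identification of the
two ends of an arrow, and (2, 0) nothing. -/
theorem toQuot_d (y : (tot (trivialAction (0 : PUnit.{1} →+ ℤ) X)).X 2) :
    X.toQuot (((tot (trivialAction (0 : PUnit.{1} →+ ℤ) X)).d 2 1).hom y) = 0 := by
  have : X.toQuot ∘ₗ ((tot (trivialAction (0 : PUnit.{1} →+ ℤ) X)).d 2 1).hom = 0 := by
    refine tot_linearMap_ext _ fun p q h g r => ?_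
    rw [LinearMap.comp_apply, LinearMap.zero_apply]
    match p, q, h, g, r with
    | 0, 2, h, g, r =>
      rw [tot_d_zero_two _ (trivialAction_onNerve X _ 0), map_add, map_sub, toQuot_zero_one,
        toQuot_zero_one, toQuot_zero_one, map_mul, QuotientGroup.mk_mul, ofMul_mul, smul_add]
      abel
    | 1, 1, h, g, r =>
      rw [tot_d_one_one, map_sub, map_sub, toQuot_zero_one, toQuot_zero_one, toQuot_one_zero,
        mk_vertex_δ, abNerveInt_map, abNerveInt_map, sub_self, sub_self]
    | 2, 0, h, g, r => rw [tot_d_two_zero, toQuot_one_zero]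
    | 0, 0, h, g, r => exact absurd h (by lia)
    | 0, 1, h, g, r => exact absurd h (by lia)
    | 0, q + 3, h, g, r => exact absurd h (by lia)
    | 1, 0, h, g, r => exact absurd h (by lia)
    | 1, q + 2, h, g, r => exact absurd h (by lia)
    | 2, q + 1, h, g, r => exact absurd h (by lia)
    | p + 3, q, h, g, r => exact absurd h (by lia)
  exact LinearMap.congr_fun this y

/-- The class of `g` modulo boundaries. -/
noncomputable def chainClass : G →* Multiplicative
    ((tot (trivialAction (0 : PUnit.{1} →+ ℤ) X)).X 1 ⧸
      LinearMap.range ((tot (trivialAction (0 : PUnit.{1} →+ ℤ) X)).d 2 1).hom) :=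
  MonoidHom.mk' (fun g => Multiplicative.ofAdd (Submodule.Quotient.mk
    (totSingle _ 0 1 1 rfl (fun _ => X.nerveConst 0 g) (abNerveOne 0)))) fun a b => by
      rw [← ofAdd_add, ← Submodule.Quotient.mk_add]
      refine congrArg Multiplicative.ofAdd (sub_eq_zero.1 ?_)
      rw [← Submodule.Quotient.mk_sub, Submodule.Quotient.mk_eq_zero]
      refine ⟨-totSingle _ 0 2 2 rfl ![X.nerveConst 0 a, X.nerveConst 0 b] (abNerveOne 0), ?_⟩
      rw [map_neg, tot_d_zero_two _ (trivialAction_onNerve X _ 0), map_mul]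
      simp only [Matrix.cons_val_zero, Matrix.cons_val_one]
      abel

theorem chainClass_eq_one_of_mem (g : G) (hg : g ∈ X.muComm) : X.chainClass g = 1 := by
  have : X.muComm ≤ X.chainClass.ker := by
    refine sup_le ?_ (Abelianization.commutator_subset_ker _)
    rintro _ ⟨h, rfl⟩
    have h2 : X.chainClass (X.μ h) = X.chainClass 1 := by
      refine congrArg Multiplicative.ofAdd (sub_eq_zero.1 ?_)
      rw [← Submodule.Quotient.mk_sub, Submodule.Quotient.mk_eq_zero]
      -- The arrow from 1 to μ(h) has horizontal boundary [1] - [μ(h)]; its vertical boundary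
      -- vanishes because the action is trivial.
      refine ⟨-totSingle _ 1 1 2 rfl (fun _ => X.nerveMk ![h, 1] 1) (abNerveOne 1), ?_⟩
      rw [map_neg, tot_d_one_one, trivialAction_onNerve, sub_self, map_zero, sub_zero, neg_sub,
        X.nerveMap_δ_zero_nerveMk h, X.nerveMap_δ_one_nerveMk h, map_one]
      rfl
    exact h2.trans (map_one _)
  exact this hg

/-- The map g ↦ [g] descends to G/(μ(H)[G, G]), and its composite with `toQuot` is the quotient map
by boundaries, as is checked on generators. -/
theorem exists_d_of_toQuot_eq_zero (x : (tot (trivialAction (0 : PUnit.{1} →+ ℤ) X)).X 1)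
    (hx : X.toQuot x = 0) :
    ∃ y, ((tot (trivialAction (0 : PUnit.{1} →+ ℤ) X)).d 2 1).hom y = x := by
  let ψ : Additive (G ⧸ X.muComm) →+ ((tot (trivialAction (0 : PUnit.{1} →+ ℤ) X)).X 1 ⧸
      LinearMap.range ((tot (trivialAction (0 : PUnit.{1} →+ ℤ) X)).d 2 1).hom) :=
    MonoidHom.toAdditiveLeft (QuotientGroup.lift X.muComm X.chainClass X.chainClass_eq_one_of_mem)
  let mk := (Submodule.mkQ (LinearMap.range
    ((tot (trivialAction (0 : PUnit.{1} →+ ℤ) X)).d 2 1).hom)).toAddMonoidHom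
  have : ψ.comp X.toQuot.toAddMonoidHom = mk := by
    refine tot_addMonoidHom_ext _ fun p q h g r => ?_
    change ψ (X.toQuot _) = mk _
    match p, q, h, g, r with
    | 0, 1, h, g, r =>
      rw [toQuot_zero_one, map_zsmul]
      have hr : r = abNerveInt 0 r • abNerveOne 0 := abNerveInt_injective 0 (by
        rw [map_zsmul, abNerveInt_one, smul_eq_mul, mul_one])
      have hg : g = fun _ => X.nerveConst 0 (X.vertex (g 0)) := funext fun j => by
        rw [nerveConst_vertex, Subsingleton.elim j 0]
      conv_rhs => rw [hr, hg, map_zsmul, map_zsmul]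
      rfl
    | 1, 0, h, g, r =>
      rw [toQuot_one_zero, map_zero]
      refine ((Submodule.Quotient.mk_eq_zero (LinearMap.range
        ((tot (trivialAction (0 : PUnit.{1} →+ ℤ) X)).d 2 1).hom)).2
        -- Every face of this constant coefficient is r, and the alternating sum of the three faces
        -- is r - r + r = r.
        ⟨totSingle _ 2 0 2 rfl default (abNerveInt 1 r • abNerveOne 2), ?_⟩).symm
      have hr : ∀ s : Fin 3, abNerveMap (0 : PUnit.{1} →+ ℤ) (SimplexCategory.δ s).toOrderHom
          (abNerveInt 1 r • abNerveOne 2) = r := fun s => abNerveInt_injective 1 (by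
        rw [abNerveInt_map, map_zsmul, abNerveInt_one, smul_eq_mul, mul_one])
      rw [tot_d_two_zero, hr, hr, hr, sub_self, zero_add, Subsingleton.elim g default]
    | 0, 0, h, g, r => exact absurd h (by lia)
    | 0, q + 2, h, g, r => exact absurd h (by lia)
    | 1, q + 1, h, g, r => exact absurd h (by lia)
    | p + 2, q, h, g, r => exact absurd h (by lia)
  have h : ψ (X.toQuot x) = Submodule.Quotient.mk x := DFunLike.congr_fun this x
  rw [hx, map_zero] at h
  exact (Submodule.Quotient.mk_eq_zero _).1 h.symm

end FirstHomology

end CrossedModule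

/-! ### Degree zero homology with abelianised coefficients, and the exact sequence. -/

namespace CrossedModule

open ModuleCat

namespace ShortExact

variable {H' G' H G H'' G'' : Type u} [Group H'] [Group G'] [Group H] [Group G]
  [Group H''] [Group G''] {X' : CrossedModule H' G'} {X : CrossedModule H G}
  {X'' : CrossedModule H'' G''} {i : Hom X' X} {p : Hom X X''} (S : ShortExact i p)

theorem conjG_mul_inv_mem (g : G) (k : G') : S.conjG g k * k⁻¹ ∈ S.relMuComm := by
  refine Subgroup.mem_sup_right (Subgroup.mem_comap.2 ?_)
  rw [map_mul, map_inv, onG_conjG]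
  exact Subgroup.commutator_mem_commutator (Subgroup.mem_top g) ⟨k, rfl⟩

theorem mk_conjG (g : G) (k : G') : (S.conjG g k : G' ⧸ S.relMuComm) = k := by
  have := (QuotientGroup.eq_one_iff (N := S.relMuComm) _).2 (S.conjG_mul_inv_mem g k)
  rwa [QuotientGroup.mk_mul, QuotientGroup.mk_inv, mul_inv_eq_one] at this

/-- The quotient `G'/(μ'(H') [G, G'])` is commutative. -/
@[reducible] def commGroupRelMuComm : CommGroup (G' ⧸ S.relMuComm) :=
  { (inferInstance : Group (G' ⧸ S.relMuComm)) with
    mul_comm := by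
      intro a b
      obtain ⟨a, rfl⟩ := QuotientGroup.mk_surjective a
      obtain ⟨b, rfl⟩ := QuotientGroup.mk_surjective b
      have h := S.mk_conjG (i.onG a) b
      rw [show S.conjG (i.onG a) b = a * b * a⁻¹ from S.injective_G (by simp [onG_conjG]),
        QuotientGroup.mk_mul, QuotientGroup.mk_mul, QuotientGroup.mk_inv,
        mul_inv_eq_iff_eq_mul] at h
      exact h }

attribute [local instance] commGroupMuComm commGroupRelMuComm

/-- The homomorphism `G'/[G', G'] → G'/(μ'(H') [G, G'])`. -/
noncomputable def abToRel : Additive (Abelianization G') →+ Additive (G' ⧸ S.relMuComm) :=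
  MonoidHom.toAdditive (Abelianization.lift (QuotientGroup.mk' S.relMuComm))

/-- The augmentation of the complex with coefficients in the abelianisation. -/
noncomputable def toRel : (tot S.action).X 0 →ₗ[ℤ] Additive (G' ⧸ S.relMuComm) :=
  totComponent _ 0 0 0 rfl fun _ => S.abToRel.toIntLinearMap ∘ₗ abVertex X'.ab

theorem toRel_zero (g : Fin 0 → X''.nerve 0) (a : abNerve X'.ab 0) :
    S.toRel (totSingle S.action 0 0 0 rfl g a) = S.abToRel (abVertex X'.ab a) :=
  totComponent_single _ _ _ _ _ _ _ _

theorem exists_nerveAb_const (X : CrossedModule H G) (a : abNerve X.ab 0) :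
    ∃ k : G, a = (X.nerveAb 0 (X.nerveConst 0 k)).toAdd := by
  obtain ⟨x, hx⟩ := X.nerveAb_surjective 0 (Multiplicative.ofAdd a)
  exact ⟨X.vertex x, by rw [nerveConst_vertex, hx]; rfl⟩

theorem nerveAb_conjG (g : G) (k : G') :
    (X'.nerveAb 0 (X'.nerveConst 0 (S.conjG g k))).toAdd =
      S.action.onNerve 0 (p.onNerve 0 (X.nerveConst 0 g))
        (X'.nerveAb 0 (X'.nerveConst 0 k)).toAdd := by
  refine S.nerveAb_conj _ _ _ ?_
  have h : ∀ k, i.onNerve 0 (X'.nerveConst 0 k) = X.nerveConst 0 (i.onG k) := fun k =>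
    Subtype.ext (funext fun e => SemidirectProduct.ext (map_one i.onH) rfl)
  rw [h, h, onG_conjG, map_mul, map_mul, map_inv]

theorem toRel_surjective (t : Additive (G' ⧸ S.relMuComm)) : ∃ m, S.toRel m = t := by
  obtain ⟨k, hk⟩ := QuotientGroup.mk_surjective t.toMul
  refine ⟨totSingle S.action 0 0 0 rfl default (X'.nerveAb 0 (X'.nerveConst 0 k)).toAdd, ?_⟩
  rw [toRel_zero]
  exact congrArg Additive.ofMul hk

/-- Vertical boundaries are differences ᵍa - a, which die modulo [G, G']; horizontal ones are, up to
sign, values of μ'. -/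
theorem toRel_d (m : (tot S.action).X 1) :
    S.toRel (((tot S.action).d 1 0).hom m) = 0 := by
  have : S.toRel ∘ₗ ((tot S.action).d 1 0).hom = 0 := by
    refine tot_linearMap_ext _ fun p' q h g a => ?_
    rw [LinearMap.comp_apply, LinearMap.zero_apply]
    match p', q, h, g, a with
    | 0, 1, h, g, a =>
      obtain ⟨x, hx⟩ := S.onNerve_surjective 0 (g 0)⁻¹
      obtain ⟨k, rfl⟩ := exists_nerveAb_const X' a
      rw [tot_d_zero_one, toRel_zero, ← hx, ← X.nerveConst_vertex x, ← S.nerveAb_conjG, map_sub,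
        map_sub, sub_eq_zero]
      exact congrArg Additive.ofMul (S.mk_conjG _ k)
    | 1, 0, h, g, a =>
      rw [tot_d_one_zero, toRel_zero, map_sub, abVertex_δ_one, map_sub, map_add, sub_add_cancel_right,
        neg_eq_zero]
      obtain ⟨c, hc⟩ := QuotientGroup.mk_surjective (a.1 (edge (Fin.le_last 0))).1.toMul
      have h1 : (a.1 (edge (Fin.le_last 0))).1 = Additive.ofMul (c : H' ⧸ X'.commH) := by
        rw [hc]; rfl
      rw [h1]
      exact congrArg Additive.ofMul ((QuotientGroup.eq_one_iff (N := S.relMuComm) (X'.μ c)).2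
        (Subgroup.mem_sup_left ⟨c, rfl⟩))
    | 0, 0, h, g, a => exact absurd h (by lia)
    | 0, q + 2, h, g, a => exact absurd h (by lia)
    | 1, q + 1, h, g, a => exact absurd h (by lia)
    | p' + 2, q, h, g, a => exact absurd h (by lia)
  exact LinearMap.congr_fun this m

/-- The class of `k` modulo boundaries. -/
noncomputable def chainClass : G' →* Multiplicative
    ((tot S.action).X 0 ⧸ LinearMap.range ((tot S.action).d 1 0).hom) :=
  MonoidHom.mk' (fun k => Multiplicative.ofAdd (Submodule.Quotient.mk
    (totSingle S.action 0 0 0 rfl default (X'.nerveAb 0 (X'.nerveConst 0 k)).toAdd))) fun a b => by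
      rw [map_mul, map_mul, toAdd_mul, map_add, Submodule.Quotient.mk_add, ofAdd_add]

theorem chainClass_eq_one_of_mem (k : G') (hk : k ∈ S.relMuComm) : S.chainClass k = 1 := by
  have : S.relMuComm ≤ S.chainClass.ker := by
    refine sup_le ?_ ?_
    · rintro _ ⟨h, rfl⟩
      refine congrArg Multiplicative.ofAdd ((Submodule.Quotient.mk_eq_zero _).2
        -- The class of the arrow from 1 to μ'(h) has boundary [1] - [μ'(h)], hence the sign.
        ⟨-totSingle S.action 1 0 1 rfl default (X'.nerveAb 1 (X'.nerveMk ![h, 1] 1)).toAdd, ?_⟩)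
      rw [map_neg, tot_d_one_zero, ← map_neg, neg_sub, ← nerveAb_nerveMap, ← nerveAb_nerveMap,
        X'.nerveMap_δ_one_nerveMk, X'.nerveMap_δ_zero_nerveMk, map_one, toAdd_one, sub_zero]
    · intro k hk
      -- The commutators live in G, so the inclusion is proved for the image in G and pulled back at
      -- the end by injectivity of `i.onG`.
      have : ⁅(⊤ : Subgroup G), i.onG.range⁆ ≤ S.chainClass.ker.map i.onG := by
        refine Subgroup.commutator_le.2 ?_
        rintro g - _ ⟨l, rfl⟩
        refine ⟨S.conjG g l * l⁻¹, ?_, ?_⟩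
        · rw [SetLike.mem_coe, MonoidHom.mem_ker, map_mul, map_inv, mul_inv_eq_one]
          refine congrArg Multiplicative.ofAdd (sub_eq_zero.1 ?_)
          rw [← Submodule.Quotient.mk_sub, Submodule.Quotient.mk_eq_zero]
          -- The bar differential acts by the inverse of the entry, so the entry is the inverse of
          -- the image of g.
          refine ⟨totSingle S.action 0 1 1 rfl (fun _ => (p.onNerve 0 (X.nerveConst 0 g))⁻¹)
            (X'.nerveAb 0 (X'.nerveConst 0 l)).toAdd, ?_⟩
          rw [tot_d_zero_one, inv_inv, ← S.nerveAb_conjG, map_sub]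
        · rw [map_mul, map_inv, onG_conjG]
          rfl
      obtain ⟨l, hl, h⟩ := this (Subgroup.mem_comap.1 hk)
      rwa [← S.injective_G h]
  exact this hk

theorem exists_d_of_toRel_eq_zero (m : (tot S.action).X 0) (hm : S.toRel m = 0) :
    ∃ m', ((tot S.action).d 1 0).hom m' = m := by
  let ψ : Additive (G' ⧸ S.relMuComm) →+
      ((tot S.action).X 0 ⧸ LinearMap.range ((tot S.action).d 1 0).hom) :=
    MonoidHom.toAdditiveLeft (QuotientGroup.lift S.relMuComm S.chainClass
      S.chainClass_eq_one_of_mem)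
  let mk := (Submodule.mkQ (LinearMap.range ((tot S.action).d 1 0).hom)).toAddMonoidHom
  have : ψ.comp S.toRel.toAddMonoidHom = mk := by
    refine tot_addMonoidHom_ext _ fun p' q h g a => ?_
    change ψ (S.toRel _) = mk _
    obtain ⟨rfl, rfl⟩ : p' = 0 ∧ q = 0 := by lia
    obtain ⟨k, rfl⟩ := exists_nerveAb_const X' a
    rw [toRel_zero, Subsingleton.elim g default]
    rfl
  have h : ψ (S.toRel m) = Submodule.Quotient.mk m := DFunLike.congr_fun this m
  rw [hm, map_zero] at h
  exact (Submodule.Quotient.mk_eq_zero _).1 h.symm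

/-- On a generator (g) ⊗ r the two sides are r times the classes of κ(g) and of g in G/(μ(H)[G, G]).
They need not agree, but their difference depends only on πg and so vanishes on the kernel. -/
theorem relQuotMap_toRel (x : (tot (trivialAction (0 : PUnit.{1} →+ ℤ) X)).X 1)
    (hx : ((HomologicalComplex₂.total.map ((AlgebraicTopology.alternatingFaceMapComplex _).map
      (simplicialChainsMap (trivialAction (0 : PUnit.{1} →+ ℤ) X'') p))
        (ComplexShape.down ℕ)).f 1).hom x = 0) :
    MonoidHom.toAdditive S.relQuotMap (S.toRel (S.bicomplexComparison.totalΦ 0 x)) =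
      X.toQuot x := by
  let Φ : (tot (trivialAction (0 : PUnit.{1} →+ ℤ) X)).X 1 →ₗ[ℤ] (tot S.action).X 0 :=
    S.bicomplexComparison.totalΦ 0
  let F : (tot (trivialAction (0 : PUnit.{1} →+ ℤ) X)).X 1 →ₗ[ℤ] Additive (G ⧸ X.muComm) :=
    (MonoidHom.toAdditive S.relQuotMap).toIntLinearMap ∘ₗ S.toRel ∘ₗ Φ - X.toQuot
  have hF : ∀ g r, F (totSingle _ 0 1 1 rfl g r) = abNerveInt 0 r •
      (Additive.ofMul (S.relQuotMap (S.abToRel (abVertex X'.ab (S.nerveDiff 0 (g 0)))).toMul) -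
        Additive.ofMul (X.vertex (g 0) : G ⧸ X.muComm)) := by
    intro g r
    have h1 : Φ (totSingle _ 0 1 1 rfl g r) =
        totSingle S.action 0 0 0 rfl default (abNerveInt 0 r • S.nerveDiff 0 (g 0)) := by
      refine (S.bicomplexComparison.totalΦ_ι 0 0 0 rfl _).trans ?_
      rw [pow_zero, one_smul]
      refine congrArg (totalι (bicomplex S.action) 0 0 0 rfl) ?_
      refine (barShift_single _ _ _ 0 g r).trans ?_
      rw [Subsingleton.elim (fun j : Fin 0 => p.onNerve 0 (g j.succ)) default]
      rfl
    change MonoidHom.toAdditive S.relQuotMap (S.toRel (Φ _)) - X.toQuot _ = _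
    rw [h1, toRel_zero, toQuot_zero_one, map_zsmul, map_zsmul, map_zsmul, smul_sub]
    rfl
  have := S.bicomplexComparison.ker_induction (S := LinearMap.ker F) (fun p' q h x hx => by
    match p', q, h, x, hx with
    | 0, 1, h, x, hx =>
      refine eq_zero_of_barMap_eq_zero (S.onNerve_surjective 0)
        (F ∘ₗ totalι (bicomplex (trivialAction (0 : PUnit.{1} →+ ℤ) X)) 0 1 1 rfl)
        (fun g g' r hg => ?_) hx
      refine (hF g r).trans (Eq.trans ?_ (hF g' r).symm)
      -- Passing from g to g·i(k) adds the class of k to both terms.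
      obtain ⟨k, hk⟩ := S.exists_mul_onNerve _ _ (hg 0)
      rw [hk, nerveDiff_mul, map_add, map_add, map_mul, toMul_add, map_mul, ofMul_mul,
        QuotientGroup.mk_mul, ofMul_mul]
      have : S.relQuotMap (S.abToRel (abVertex X'.ab (X'.nerveAb 0 k).toAdd)).toMul =
        (X.vertex (i.onNerve 0 k) : G ⧸ X.muComm) := rfl
      rw [this, add_sub_add_right_eq_sub]
    | 1, 0, h, x, hx =>
      have h0 : totalι (bicomplex (trivialAction (0 : PUnit.{1} →+ ℤ) X)) 1 0 1 h x = 0 :=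
        (congrArg _ (S.bicomplexComparison.eq_zero 1 x hx)).trans (map_zero (totalι _ 1 0 1 h))
      exact (congrArg F h0).trans (map_zero F)
    | 0, 0, h, x, hx => exact absurd h (by lia)
    | 0, q + 2, h, x, hx => exact absurd h (by lia)
    | 1, q + 1, h, x, hx => exact absurd h (by lia)
    | p' + 2, q, h, x, hx => exact absurd h (by lia)) x hx
  exact sub_eq_zero.1 this

/-- Since `p` is onto on both groups, it maps μ(H)[G, G] onto μ''(H'')[G'', G'']. An element of the
kernel can therefore be corrected by μ(H)[G, G] to come from G'. -/
theorem exact_relQuotMap_quotMap : Function.Exact (MonoidHom.toAdditive S.relQuotMap)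
    (MonoidHom.toAdditive (quotMap p)) := by
  intro x
  obtain ⟨g, hg⟩ := QuotientGroup.mk_surjective x.toMul
  obtain rfl : x = Additive.ofMul (g : G ⧸ X.muComm) := congrArg Additive.ofMul hg.symm
  constructor
  · intro h
    have h1 : p.onG g ∈ X''.muComm := (QuotientGroup.eq_one_iff _).1 h
    have h2 : X''.muComm ≤ X.muComm.map p.onG := by
      refine sup_le ?_ ?_
      · rintro _ ⟨h, rfl⟩
        obtain ⟨h, rfl⟩ := S.surjective_H h
        exact ⟨X.μ h, Subgroup.mem_sup_left ⟨h, rfl⟩, (p.comm h).symm⟩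
      · refine Subgroup.commutator_le.2 fun a _ b _ => ?_
        obtain ⟨a, rfl⟩ := S.surjective_G a
        obtain ⟨b, rfl⟩ := S.surjective_G b
        exact ⟨a * b * a⁻¹ * b⁻¹, Subgroup.mem_sup_right (Subgroup.commutator_mem_commutator
          (Subgroup.mem_top a) (Subgroup.mem_top b)), by simp [commutatorElement_def]⟩
    obtain ⟨m, hm, hmg⟩ := h2 h1
    obtain ⟨k, hk⟩ := S.exists_onG (g := m⁻¹ * g) (by rw [map_mul, map_inv, hmg, inv_mul_cancel])
    refine ⟨Additive.ofMul (k : G' ⧸ S.relMuComm), ?_⟩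
    change Additive.ofMul (i.onG k : G ⧸ X.muComm) = _
    rw [hk, QuotientGroup.mk_mul, QuotientGroup.mk_inv,
      (QuotientGroup.eq_one_iff (N := X.muComm) m).2 hm, inv_one, one_mul]
  · rintro ⟨y, hy⟩
    obtain ⟨k, hk⟩ := QuotientGroup.mk_surjective y.toMul
    obtain rfl : y = Additive.ofMul (k : G' ⧸ S.relMuComm) := congrArg Additive.ofMul hk.symm
    rw [← hy]
    change Additive.ofMul (p.onG (i.onG k) : G'' ⧸ X''.muComm) = 0
    rw [S.onG_onG]
    rfl

theorem quotMap_surjective (S : ShortExact i p) :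
    Function.Surjective (MonoidHom.toAdditive (quotMap p)) := by
  intro x
  obtain ⟨g, hg⟩ := QuotientGroup.mk_surjective x.toMul
  obtain ⟨g, rfl⟩ := S.surjective_G g
  exact ⟨Additive.ofMul (g : G ⧸ X.muComm), congrArg Additive.ofMul hg⟩

theorem exists_exact_integralHomology :
    ∃ δ : X''.integralHomology 2 →+ Additive (G' ⧸ S.relMuComm),
      Function.Exact (integralHomologyMap p 2) δ ∧
      Function.Exact δ (MonoidHom.toAdditive S.relQuotMap) :=
  S.bicomplexComparison.shiftedComparison.exists_exact (MonoidHom.toAdditive S.relQuotMap)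
    S.toRel S.toRel_surjective S.toRel_d S.exists_d_of_toRel_eq_zero X.toQuot X.toQuot_d
    X.exists_d_of_toQuot_eq_zero S.relQuotMap_toRel

end ShortExact

end CrossedModule

/-! ### The exact sequence and the epimorphism onto the cokernel. -/

theorem proposition7 {H' G' H G H'' G'' : Type u} [Group H'] [Group G'] [Group H] [Group G]
    [Group H''] [Group G''] (X' : CrossedModule H' G') (X : CrossedModule H G)
    (X'' : CrossedModule H'' G'') (i : CrossedModule.Hom X' X) (p : CrossedModule.Hom X X'')
    (S : CrossedModule.ShortExact i p) :
    (∃ δ : X''.integralHomology 2 →+ Additive (G' ⧸ S.relMuComm),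
      Function.Exact (CrossedModule.integralHomologyMap p 2) δ ∧
      Function.Exact δ (MonoidHom.toAdditive S.relQuotMap) ∧
      Function.Exact (MonoidHom.toAdditive S.relQuotMap)
        (MonoidHom.toAdditive (CrossedModule.quotMap p)) ∧
      Function.Surjective (MonoidHom.toAdditive (CrossedModule.quotMap p))) ∧
    ∃ d : X''.integralHomology 3 →ₗ[ℤ] CrossedModule.homology S.action 1,
      ∃ e : LinearMap.ker (CrossedModule.integralHomologyMap p 2) →ₗ[ℤ]
          (CrossedModule.homology S.action 1 ⧸ LinearMap.range d),
        Function.Surjective e := by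
  obtain ⟨δ, h1, h2⟩ := S.exists_exact_integralHomology
  refine ⟨⟨δ, h1, h2, S.exact_relQuotMap_quotMap, S.quotMap_surjective⟩, ?_⟩
  obtain ⟨d, e, he⟩ := S.bicomplexComparison.shiftedComparison.exists_surjective
  -- Linearity of `e` is derived afresh from additivity, so that it holds for the ℤ-module
  -- structures of the statement.
  refine ⟨d, ⟨e.toAddMonoidHom.toAddHom, fun c x => ?_⟩, he⟩
  exact map_intCast_smul e.toAddMonoidHom ℤ ℤ c x
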